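/- Let $W$ be the Weyl group of type $A_{n-1}$ ($n\ge 1$, $W=S_n$), $B_n$ ($n\ge 2$) or $D_n$ ($n\ge 4$), with simple reflections indexed by $i=1,\dots,n-1$ in type $A_{n-1}$ and $i=1,\dots,n$ in types $B_n,D_n$. Let $m_{ij}$ be the Coxeter integers: $m_{ii}=1$; for $i\neq j$, $m_{ij}=3$ if $i,j$ are joined by an unmarked edge, $4$ if joined by an edge marked $4$, and $2$ otherwise. The diagram of $A_{n-1}$ is the path $1-2-\cdots-(n-1)$; that of $B_n$ is the path $1-2-\cdots-n$ whose edge $\{n-1,n\}$ is marked $4$; that of $D_n$ is the path $1-\cdots-(n-1)$ together with an unmarked edge $\{n-2,n\}$. Let $O=\{1\}$ in types $A,B$, $O=\{n\}$ in type $D_n$ with $n$ odd, and $O=\{1,n\}$ in type $D_n$ with $n$ even. **The spin extended affine Weyl group algebra.** Let $\widetilde W^e$ be the group generated by $z$, $\tilde t_i$, $\tilde\pi_r$ ($r\in O$) such that $z$ is central, $z^2=1$, $(\tilde t_i\tilde t_j)^{m_{ij}}=1$ if $m_{ij}\in\{1,3\}$ and $=z$ if $m_{ij}\in\{2,4\}$,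 and moreover: * type $A_{n-1}$: $\tilde\pi_1^2\tilde t_{n-1}=\tilde t_1\tilde\pi_1^2$; $\tilde\pi_1^n\tilde t_i=\tilde t_i\tilde\pi_1^n$ for $1\le i\le n-1$; $\tilde\pi_1\tilde t_i=z^{n-1}\tilde t_{i+1}\tilde\pi_1$ for $1\le i\le n-2$ (relations in which a nonexistent $\tilde t_i$ occurs are omitted); * type $B_n$: $\tilde\pi_1^2=1$; $\tilde\pi_1\tilde t_i=z\tilde t_i\tilde\pi_1$ for $2\le i\le n$; $\tilde\pi_1\tilde t_1\tilde\pi_1\tilde t_1=z\tilde t_1\tilde\pi_1\tilde t_1\tilde\pi_1$; * type $D_n$, $n$ odd: $\tilde\pi_n^4=z$; $\tilde\pi_n^2\tilde t_{n-1}=\tilde t_n\tilde\pi_n^2$; $\tilde\pi_n\tilde t_i=z^{(n-1)/2}\tilde t_{n-i}\tilde\pi_n$ for $1\le i\le n-2$; $\tilde\pi_n\tilde t_n=z^{(n-1)/2}\tilde t_1\tilde\pi_n$; * type $D_n$, $n$ even: $\tilde\pi_1^2=1$; $\tilde\pi_n^2=z^{n/2+1}$; $\tilde\pi_1\tilde\pi_n=z\tilde\pi_n\tilde\pi_1$;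 $\tilde\pi_1\tilde t_1\tilde\pi_1=z\tilde\pi_n\tilde t_n\tilde\pi_n$; $\tilde\pi_1\tilde t_i=\tilde t_i\tilde\pi_1$ and $\tilde\pi_n\tilde t_i=z^{n/2}\tilde t_{n-i}\tilde\pi_n$ for $2\le i\le n-2$; $\tilde\pi_1\tilde t_{n-1}=\tilde t_n\tilde\pi_1$; $\tilde\pi_n\tilde t_1=z^{n/2}\tilde t_{n-1}\tilde\pi_n$. Put $\mathbb C W^{e-}=\mathbb C\widetilde W^e/\langle z+1\rangle$, and let $t_i$, $t_{\pi_r}$ be the images of $\tilde t_i$, $\tilde\pi_r$. **The skew-polynomial algebra.** $\mathcal C[\xi_1,\dots,\xi_n]$ is the $\mathbb C$-algebra generated by $\xi_1,\dots,\xi_n$ subject to $\xi_i\xi_j+\xi_j\xi_i=0$ for $i\ne j$. **The trigonometric spin double affine Hecke algebra.** Let $u,v\in\mathbb C$ ($v$ is used only in type $B_n$). $\ddot H^-_W$ is the $\mathbb C$-algebra generated by $\mathcal C[\xi_1,\dots,\xi_n]$ and $\mathbb C W^{e-}$ (i.e. the quotient of their free product) subject to $$t_i\xi_i=-\xi_{i+1}t_i+u,\qquad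 t_i\xi_j=-\xi_jt_i\quad (1\le i\le n-1,\ j\ne i,i+1)$$ and moreover: * type $A_{n-1}$: $t_{\pi_1}\xi_i=(-1)^{n-1}\xi_{i+1}t_{\pi_1}$ for $1\le i\le n-1$; $t_{\pi_1}\xi_n=(-1)^{n-1}\xi_1t_{\pi_1}$; * type $B_n$: $t_n\xi_n=-\xi_nt_n+v$; $t_n\xi_i=-\xi_it_n$ for $i\ne n$; $t_{\pi_1}\xi_i=-\xi_it_{\pi_1}$ for $1\le i\le n$; * type $D_n$: $t_n\xi_n=-\xi_{n-1}t_n+u$; $t_n\xi_i=-\xi_it_n$ for $i\ne n-1,n$; if $n$ is odd, $t_{\pi_n}\xi_i=(-1)^{(n-1)/2}\xi_{n+1-i}t_{\pi_n}$ for $1\le i\le n$; if $n$ is even, $t_{\pi_1}\xi_i=\xi_it_{\pi_1}$ and $t_{\pi_n}\xi_i=(-1)^{n/2}\xi_{n+1-i}t_{\pi_n}$ for $1\le i\le n$. **Theorem.** For $W$ of type $A_{n-1}$, $B_n$ or $D_n$ as above and all $u,v\in\mathbb C$, multiplication $a\otimes b\mapsto ab$ (of the images of $a$ and $b$ in $\ddot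 H^-_W$) induces an isomorphism of vector spaces $$\mathcal C[\xi_1,\dots,\xi_n]\otimes\mathbb C W^{e-}\ \stackrel{\simeq}{\longrightarrow}\ \ddot H^-_W .$$ -/

import Mathlib

open scoped TensorProduct

namespace SpinDAHA

/-- The three classical types. `A` with parameter `n` stands for type `A_{n-1}` (so `W = S_n`),
`B` for `B_n`, and `D` for `D_n`; in all three cases `n` is the number of variables. -/
inductive ClassicalType where
  | A
  | B
  | D

/-- The ranges of `n`: `A_{n-1}` with `1 ≤ n`, `B_n` with `2 ≤ n`, `D_n` with `4 ≤ n`. -/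
def Admissible : ClassicalType → ℕ → Prop
  | .A, n => 1 ≤ n
  | .B, n => 2 ≤ n
  | .D, n => 4 ≤ n

/-- The number of simple reflections: `n - 1` in type `A_{n-1}`, and `n` in types `B_n`, `D_n`. -/
def rank : ClassicalType → ℕ → ℕ
  | .A, n => n - 1
  | .B, n => n
  | .D, n => n

/-- The index set `{1, …, m}`. -/
abbrev Idx (m : ℕ) : Type := {i : ℕ // 1 ≤ i ∧ i ≤ m}

/-- The Coxeter integers `m_{ij}`, nodes being numbered from `1`. Type `A`: the path
`1 - 2 - ⋯ - (n-1)`. Type `B`: the path `1 - ⋯ - n` whose last edge is marked `4`.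
Type `D`: the path `1 - ⋯ - (n-1)` with the node `n` joined to the node `n-2`. -/
def coxeterM : ClassicalType → ℕ → ℕ → ℕ → ℕ
  | .A, _, i, j => if i = j then 1 else if j = i + 1 ∨ i = j + 1 then 3 else 2
  | .B, n, i, j =>
      if i = j then 1
      else if j = i + 1 ∨ i = j + 1 then (if i = n ∨ j = n then 4 else 3)
      else 2
  | .D, n, i, j =>
      if i = j then 1
      else if i = n then (if j + 2 = n then 3 else 2)
      else if j = n then (if i + 2 = n then 3 else 2)
      else if j = i + 1 ∨ i = j + 1 then 3
      else 2

/-- The set `O_W^*` of indices `r` of the generators `π_r`: `{1}` in types `A` and `B`, `{1, n}`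
in type `D_n` with `n` even, and `{n}` in type `D_n` with `n` odd. -/
def piIndices : ClassicalType → ℕ → Set ℕ
  | .A, _ => {1}
  | .B, _ => {1}
  | .D, n => {r | (Even n ∧ r = 1) ∨ r = n}

/-- The index set of the `π_r`. -/
abbrev PiIdx (X : ClassicalType) (n : ℕ) : Type := {r : ℕ // r ∈ piIndices X n}

/-! ### The covering of the extended affine Weyl group -/

/-- Generators `z`, `t̃_i`, `π̃_r` of the covering group. -/
inductive CoverGen (X : ClassicalType) (n : ℕ) : Type where
  | z : CoverGen X n
  | t (i : Idx (rank X n)) : CoverGen X n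
  | pi (r : PiIdx X n) : CoverGen X n

section CoverWords

variable {X : ClassicalType} {n : ℕ}

/-- The letter `z` of the free group. -/
def wz : FreeGroup (CoverGen X n) := FreeGroup.of CoverGen.z

/-- The letter `t̃_i` of the free group. -/
def wt (i : Idx (rank X n)) : FreeGroup (CoverGen X n) := FreeGroup.of (CoverGen.t i)

/-- The letter `π̃_r` of the free group. -/
def wpi (r : PiIdx X n) : FreeGroup (CoverGen X n) := FreeGroup.of (CoverGen.pi r)

end CoverWords

/-- The defining relations `a = b` of the covering `W̃^e` of the extended affine Weyl group. -/
inductive CoverRel (X : ClassicalType) (n : ℕ) :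
    FreeGroup (CoverGen X n) → FreeGroup (CoverGen X n) → Prop where
  /- `z` is central with `z ^ 2 = 1` -/
  | z_sq : CoverRel X n (wz ^ 2) 1
  | z_t (i : Idx (rank X n)) : CoverRel X n (wz * wt i) (wt i * wz)
  | z_pi (r : PiIdx X n) : CoverRel X n (wz * wpi r) (wpi r * wz)
  /- `(t̃_i t̃_j) ^ {m_ij}` is `1` for `m_ij = 1, 3` and `z` for `m_ij = 2, 4` -/
  | coxeter_odd (i j : Idx (rank X n))
      (h : coxeterM X n i j = 1 ∨ coxeterM X n i j = 3) :
      CoverRel X n ((wt i * wt j) ^ coxeterM X n i j) 1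
  | coxeter_even (i j : Idx (rank X n))
      (h : coxeterM X n i j = 2 ∨ coxeterM X n i j = 4) :
      CoverRel X n ((wt i * wt j) ^ coxeterM X n i j) wz
  /- type `A_{n-1}` -/
  | A_sq (hX : X = .A) (r : PiIdx X n) (i j : Idx (rank X n))
      (hi : (i : ℕ) = n - 1) (hj : (j : ℕ) = 1) :
      CoverRel X n (wpi r ^ 2 * wt i) (wt j * wpi r ^ 2)
  | A_pow (hX : X = .A) (r : PiIdx X n) (i : Idx (rank X n)) :
      CoverRel X n (wpi r ^ n * wt i) (wt i * wpi r ^ n)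
  | A_shift (hX : X = .A) (r : PiIdx X n) (i j : Idx (rank X n)) (hj : (j : ℕ) = i + 1) :
      CoverRel X n (wpi r * wt i) (wz ^ (n - 1) * wt j * wpi r)
  /- type `B_n` -/
  | B_sq (hX : X = .B) (r : PiIdx X n) : CoverRel X n (wpi r ^ 2) 1
  | B_comm (hX : X = .B) (r : PiIdx X n) (i : Idx (rank X n)) (hi : 2 ≤ (i : ℕ)) :
      CoverRel X n (wpi r * wt i) (wz * wt i * wpi r)
  | B_braid (hX : X = .B) (r : PiIdx X n) (i : Idx (rank X n)) (hi : (i : ℕ) = 1) :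
      CoverRel X n (wpi r * wt i * wpi r * wt i) (wz * wt i * wpi r * wt i * wpi r)
  /- type `D_n`, `n` odd; `r` is the index of `π̃_n` -/
  | Dodd_pow (hX : X = .D) (hn : Odd n) (r : PiIdx X n) : CoverRel X n (wpi r ^ 4) wz
  | Dodd_sq (hX : X = .D) (hn : Odd n) (r : PiIdx X n) (i j : Idx (rank X n))
      (hi : (i : ℕ) = n - 1) (hj : (j : ℕ) = n) :
      CoverRel X n (wpi r ^ 2 * wt i) (wt j * wpi r ^ 2)
  | Dodd_flip (hX : X = .D) (hn : Odd n) (r : PiIdx X n) (i j : Idx (rank X n))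
      (hi : (i : ℕ) ≤ n - 2) (hj : (j : ℕ) = n - i) :
      CoverRel X n (wpi r * wt i) (wz ^ ((n - 1) / 2) * wt j * wpi r)
  | Dodd_last (hX : X = .D) (hn : Odd n) (r : PiIdx X n) (i j : Idx (rank X n))
      (hi : (i : ℕ) = n) (hj : (j : ℕ) = 1) :
      CoverRel X n (wpi r * wt i) (wz ^ ((n - 1) / 2) * wt j * wpi r)
  /- type `D_n`, `n` even; `p` is the index of `π̃_1` and `q` that of `π̃_n` -/
  | Deven_sq_one (hX : X = .D) (hn : Even n) (p : PiIdx X n) (hp : (p : ℕ) = 1) :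
      CoverRel X n (wpi p ^ 2) 1
  | Deven_sq_n (hX : X = .D) (hn : Even n) (q : PiIdx X n) (hq : (q : ℕ) = n) :
      CoverRel X n (wpi q ^ 2) (wz ^ (n / 2 + 1))
  | Deven_pi_pi (hX : X = .D) (hn : Even n) (p q : PiIdx X n)
      (hp : (p : ℕ) = 1) (hq : (q : ℕ) = n) :
      CoverRel X n (wpi p * wpi q) (wz * wpi q * wpi p)
  | Deven_conj (hX : X = .D) (hn : Even n) (p q : PiIdx X n)
      (hp : (p : ℕ) = 1) (hq : (q : ℕ) = n) (i j : Idx (rank X n))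
      (hi : (i : ℕ) = 1) (hj : (j : ℕ) = n) :
      CoverRel X n (wpi p * wt i * wpi p) (wz * wpi q * wt j * wpi q)
  | Deven_one_comm (hX : X = .D) (hn : Even n) (p : PiIdx X n) (hp : (p : ℕ) = 1)
      (i : Idx (rank X n)) (hi : 2 ≤ (i : ℕ)) (hi' : (i : ℕ) ≤ n - 2) :
      CoverRel X n (wpi p * wt i) (wt i * wpi p)
  | Deven_n_flip (hX : X = .D) (hn : Even n) (q : PiIdx X n) (hq : (q : ℕ) = n)
      (i j : Idx (rank X n)) (hi : 2 ≤ (i : ℕ)) (hi' : (i : ℕ) ≤ n - 2)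
      (hj : (j : ℕ) = n - i) :
      CoverRel X n (wpi q * wt i) (wz ^ (n / 2) * wt j * wpi q)
  | Deven_one_last (hX : X = .D) (hn : Even n) (p : PiIdx X n) (hp : (p : ℕ) = 1)
      (i j : Idx (rank X n)) (hi : (i : ℕ) = n - 1) (hj : (j : ℕ) = n) :
      CoverRel X n (wpi p * wt i) (wt j * wpi p)
  | Deven_n_first (hX : X = .D) (hn : Even n) (q : PiIdx X n) (hq : (q : ℕ) = n)
      (i j : Idx (rank X n)) (hi : (i : ℕ) = 1) (hj : (j : ℕ) = n - 1) :
      CoverRel X n (wpi q * wt i) (wz ^ (n / 2) * wt j * wpi q)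

/-- The covering `W̃^e` of the extended affine Weyl group. -/
abbrev Cover (X : ClassicalType) (n : ℕ) : Type :=
  PresentedGroup {w : FreeGroup (CoverGen X n) | ∃ a b, CoverRel X n a b ∧ w = a * b⁻¹}

/-- The image of a generator in `W̃^e`. -/
def Cover.gen {X : ClassicalType} {n : ℕ} (g : CoverGen X n) : Cover X n :=
  PresentedGroup.of g

noncomputable section

/-! ### The spin extended affine Weyl group algebra -/

/-- The relation `z + 1 = 0` in the group algebra of `W̃^e`. -/
inductive SpinRel (X : ClassicalType) (n : ℕ) :
    MonoidAlgebra ℂ (Cover X n) → MonoidAlgebra ℂ (Cover X n) → Prop where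
  | z_add_one :
      SpinRel X n (MonoidAlgebra.of ℂ (Cover X n) (Cover.gen CoverGen.z) + 1) 0

/-- The spin extended affine Weyl group algebra `ℂW^{e-} = ℂW̃^e / ⟨z + 1⟩`. -/
def SpinWeyl (X : ClassicalType) (n : ℕ) : Type := RingQuot (SpinRel X n)

instance (X : ClassicalType) (n : ℕ) : Ring (SpinWeyl X n) :=
  inferInstanceAs (Ring (RingQuot (SpinRel X n)))

instance (X : ClassicalType) (n : ℕ) : Algebra ℂ (SpinWeyl X n) :=
  inferInstanceAs (Algebra ℂ (RingQuot (SpinRel X n)))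

/-- The quotient map `ℂW̃^e → ℂW^{e-}`. -/
def SpinWeyl.mk (X : ClassicalType) (n : ℕ) :
    MonoidAlgebra ℂ (Cover X n) →ₐ[ℂ] SpinWeyl X n :=
  RingQuot.mkAlgHom ℂ (SpinRel X n)

/-- The generator `t_i` of `ℂW^{e-}`. -/
def SpinWeyl.t {X : ClassicalType} {n : ℕ} (i : Idx (rank X n)) : SpinWeyl X n :=
  SpinWeyl.mk X n (MonoidAlgebra.of ℂ (Cover X n) (Cover.gen (CoverGen.t i)))

/-- The generator `t_{π_r}` of `ℂW^{e-}`. -/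
def SpinWeyl.tpi {X : ClassicalType} {n : ℕ} (r : PiIdx X n) : SpinWeyl X n :=
  SpinWeyl.mk X n (MonoidAlgebra.of ℂ (Cover X n) (Cover.gen (CoverGen.pi r)))

/-! ### The skew-polynomial algebra -/

/-- The relations `ξ_i ξ_j + ξ_j ξ_i = 0` for `i ≠ j`. -/
inductive SkewRel (n : ℕ) : FreeAlgebra ℂ (Idx n) → FreeAlgebra ℂ (Idx n) → Prop where
  | anticomm (i j : Idx n) (h : i ≠ j) :
      SkewRel n (FreeAlgebra.ι ℂ i * FreeAlgebra.ι ℂ j + FreeAlgebra.ι ℂ j * FreeAlgebra.ι ℂ i) 0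

/-- The skew-polynomial algebra `𝒞[ξ_1, …, ξ_n]`. -/
def Skew (n : ℕ) : Type := RingQuot (SkewRel n)

instance (n : ℕ) : Ring (Skew n) := inferInstanceAs (Ring (RingQuot (SkewRel n)))

instance (n : ℕ) : Algebra ℂ (Skew n) := inferInstanceAs (Algebra ℂ (RingQuot (SkewRel n)))

/-- The generator `ξ_i`. -/
def Skew.ξ {n : ℕ} (i : Idx n) : Skew n :=
  RingQuot.mkAlgHom ℂ (SkewRel n) (FreeAlgebra.ι ℂ i)

/-! ### The trigonometric spin double affine Hecke algebra -/

/-- The free algebra on the disjoint union of (the underlying sets of) `𝒞[ξ]` and `ℂW^{e-}`. -/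
abbrev PreDAHA (X : ClassicalType) (n : ℕ) : Type := FreeAlgebra ℂ (Skew n ⊕ SpinWeyl X n)

section PreElements

variable {X : ClassicalType} {n : ℕ}

/-- The letter attached to an element of `𝒞[ξ]`. -/
def pl (a : Skew n) : PreDAHA X n := FreeAlgebra.ι ℂ (Sum.inl a)

/-- The letter attached to an element of `ℂW^{e-}`. -/
def pr (b : SpinWeyl X n) : PreDAHA X n := FreeAlgebra.ι ℂ (Sum.inr b)

/-- `ξ_i` as a letter. -/
def pξ (i : Idx n) : PreDAHA X n := pl (Skew.ξ i)

/-- `t_i` as a letter. -/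
def pt (i : Idx (rank X n)) : PreDAHA X n := pr (SpinWeyl.t i)

/-- `t_{π_r}` as a letter. -/
def ptpi (r : PiIdx X n) : PreDAHA X n := pr (SpinWeyl.tpi r)

end PreElements

/-- The defining relations of the trigonometric spin double affine Hecke algebra. The first eight
say that `𝒞[ξ]` and `ℂW^{e-}` map to it by homomorphisms of unital `ℂ`-algebras (that is, they
define the free product of the two algebras); the others are the cross relations. The parameter
`v` occurs only in type `B`. -/
inductive DAHARel (X : ClassicalType) (n : ℕ) (u v : ℂ) :
    PreDAHA X n → PreDAHA X n → Prop where
  | l_add (a b : Skew n) : DAHARel X n u v (pl (a + b)) (pl a + pl b)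
  | l_mul (a b : Skew n) : DAHARel X n u v (pl (a * b)) (pl a * pl b)
  | l_one : DAHARel X n u v (pl 1) 1
  | l_smul (c : ℂ) (a : Skew n) : DAHARel X n u v (pl (c • a)) (c • pl a)
  | r_add (a b : SpinWeyl X n) : DAHARel X n u v (pr (a + b)) (pr a + pr b)
  | r_mul (a b : SpinWeyl X n) : DAHARel X n u v (pr (a * b)) (pr a * pr b)
  | r_one : DAHARel X n u v (pr 1) 1
  | r_smul (c : ℂ) (a : SpinWeyl X n) : DAHARel X n u v (pr (c • a)) (c • pr a)
  /- all types: `t_i ξ_i = - ξ_{i+1} t_i + u` and `t_i ξ_j = - ξ_j t_i` for `1 ≤ i ≤ n - 1`,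
  `j ≠ i, i + 1` -/
  | t_ξ_self (i : Idx (rank X n)) (j k : Idx n) (hi : (i : ℕ) ≤ n - 1)
      (hj : (j : ℕ) = i) (hk : (k : ℕ) = i + 1) :
      DAHARel X n u v (pt i * pξ j) (-(pξ k * pt i) + algebraMap ℂ _ u)
  | t_ξ_other (i : Idx (rank X n)) (j : Idx n) (hi : (i : ℕ) ≤ n - 1)
      (hj : (j : ℕ) ≠ i) (hj' : (j : ℕ) ≠ i + 1) :
      DAHARel X n u v (pt i * pξ j) (-(pξ j * pt i))
  /- type `A_{n-1}` -/
  | A_pi (hX : X = .A) (r : PiIdx X n) (i j : Idx n) (hj : (j : ℕ) = i + 1) :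
      DAHARel X n u v (ptpi r * pξ i) ((-1) ^ (n - 1) * pξ j * ptpi r)
  | A_pi_last (hX : X = .A) (r : PiIdx X n) (i j : Idx n)
      (hi : (i : ℕ) = n) (hj : (j : ℕ) = 1) :
      DAHARel X n u v (ptpi r * pξ i) ((-1) ^ (n - 1) * pξ j * ptpi r)
  /- type `B_n` -/
  | B_ξ_self (hX : X = .B) (i : Idx (rank X n)) (j : Idx n)
      (hi : (i : ℕ) = n) (hj : (j : ℕ) = n) :
      DAHARel X n u v (pt i * pξ j) (-(pξ j * pt i) + algebraMap ℂ _ v)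
  | B_ξ_other (hX : X = .B) (i : Idx (rank X n)) (j : Idx n)
      (hi : (i : ℕ) = n) (hj : (j : ℕ) ≠ n) :
      DAHARel X n u v (pt i * pξ j) (-(pξ j * pt i))
  | B_pi (hX : X = .B) (r : PiIdx X n) (i : Idx n) :
      DAHARel X n u v (ptpi r * pξ i) (-(pξ i * ptpi r))
  /- type `D_n` -/
  | D_ξ_self (hX : X = .D) (i : Idx (rank X n)) (j k : Idx n)
      (hi : (i : ℕ) = n) (hj : (j : ℕ) = n) (hk : (k : ℕ) = n - 1) :
      DAHARel X n u v (pt i * pξ j) (-(pξ k * pt i) + algebraMap ℂ _ u)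
  | D_ξ_other (hX : X = .D) (i : Idx (rank X n)) (j : Idx n)
      (hi : (i : ℕ) = n) (hj : (j : ℕ) ≠ n - 1) (hj' : (j : ℕ) ≠ n) :
      DAHARel X n u v (pt i * pξ j) (-(pξ j * pt i))
  | Dodd_pi (hX : X = .D) (hn : Odd n) (r : PiIdx X n) (i j : Idx n)
      (hj : (j : ℕ) = n + 1 - i) :
      DAHARel X n u v (ptpi r * pξ i) ((-1) ^ ((n - 1) / 2) * pξ j * ptpi r)
  | Deven_pi_one (hX : X = .D) (hn : Even n) (p : PiIdx X n) (hp : (p : ℕ) = 1) (i : Idx n) :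
      DAHARel X n u v (ptpi p * pξ i) (pξ i * ptpi p)
  | Deven_pi_n (hX : X = .D) (hn : Even n) (q : PiIdx X n) (hq : (q : ℕ) = n) (i j : Idx n)
      (hj : (j : ℕ) = n + 1 - i) :
      DAHARel X n u v (ptpi q * pξ i) ((-1) ^ (n / 2) * pξ j * ptpi q)

/-- The trigonometric spin double affine Hecke algebra `Ḧ^-_W`. -/
def SpinDoubleHecke (X : ClassicalType) (n : ℕ) (u v : ℂ) : Type := RingQuot (DAHARel X n u v)

instance (X : ClassicalType) (n : ℕ) (u v : ℂ) : Ring (SpinDoubleHecke X n u v) :=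
  inferInstanceAs (Ring (RingQuot (DAHARel X n u v)))

instance (X : ClassicalType) (n : ℕ) (u v : ℂ) : Algebra ℂ (SpinDoubleHecke X n u v) :=
  inferInstanceAs (Algebra ℂ (RingQuot (DAHARel X n u v)))

section Maps

variable (X : ClassicalType) (n : ℕ) (u v : ℂ)

/-- The quotient map onto `Ḧ^-_W`. -/
def SpinDoubleHecke.mk : PreDAHA X n →ₐ[ℂ] SpinDoubleHecke X n u v :=
  RingQuot.mkAlgHom ℂ (DAHARel X n u v)

theorem SpinDoubleHecke.mk_rel {a b : PreDAHA X n} (h : DAHARel X n u v a b) :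
    SpinDoubleHecke.mk X n u v a = SpinDoubleHecke.mk X n u v b :=
  RingQuot.mkAlgHom_rel ℂ h

/-- The canonical algebra homomorphism `𝒞[ξ_1, …, ξ_n] → Ḧ^-_W`. -/
def fromSkew : Skew n →ₐ[ℂ] SpinDoubleHecke X n u v :=
  AlgHom.ofLinearMap
    { toFun := fun a => SpinDoubleHecke.mk X n u v (pl a)
      map_add' := fun a b => by
        rw [SpinDoubleHecke.mk_rel X n u v (.l_add a b), map_add]
      map_smul' := fun c a => by
        rw [SpinDoubleHecke.mk_rel X n u v (.l_smul c a), map_smul, RingHom.id_apply] }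
    (by
      change SpinDoubleHecke.mk X n u v (pl 1) = 1
      rw [SpinDoubleHecke.mk_rel X n u v .l_one, map_one])
    (fun a b => by
      change SpinDoubleHecke.mk X n u v (pl (a * b)) =
        SpinDoubleHecke.mk X n u v (pl a) * SpinDoubleHecke.mk X n u v (pl b)
      rw [SpinDoubleHecke.mk_rel X n u v (.l_mul a b), map_mul])

/-- The canonical algebra homomorphism `ℂW^{e-} → Ḧ^-_W`. -/
def fromSpinWeyl : SpinWeyl X n →ₐ[ℂ] SpinDoubleHecke X n u v :=
  AlgHom.ofLinearMap
    { toFun := fun a => SpinDoubleHecke.mk X n u v (pr a)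
      map_add' := fun a b => by
        rw [SpinDoubleHecke.mk_rel X n u v (.r_add a b), map_add]
      map_smul' := fun c a => by
        rw [SpinDoubleHecke.mk_rel X n u v (.r_smul c a), map_smul, RingHom.id_apply] }
    (by
      change SpinDoubleHecke.mk X n u v (pr 1) = 1
      rw [SpinDoubleHecke.mk_rel X n u v .r_one, map_one])
    (fun a b => by
      change SpinDoubleHecke.mk X n u v (pr (a * b)) =
        SpinDoubleHecke.mk X n u v (pr a) * SpinDoubleHecke.mk X n u v (pr b)
      rw [SpinDoubleHecke.mk_rel X n u v (.r_mul a b), map_mul])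

end Maps

end

end SpinDAHA

/-!
Surjectivity only needs that the `ξ_k` can be moved to the left of the other generators. Injectivity
is proved by making `Ḧ^-_W` act on `𝒞[ξ] ⊗ ℂW^{e-}` in the way it would act on itself by left
multiplication if the theorem were true.

The algebra `𝒞[ξ]` acts by left multiplication on the first factor. Every generator `g = t_i` or
`t_{π_r}` obeys a rule `g ξ_k = ε ξ_{s k} g + c_k`, with `s` a permutation, `ε` a sign, and `c_k` a
scalar. There is exactly one operator on `𝒞[ξ] ⊗ ℂW^{e-}` which obeys the same rule and sends
`1 ⊗ b` to `1 ⊗ g b` (`Twist.op`); it exists because the rule is compatible with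
`ξ_k ξ_l + ξ_l ξ_k = 0`.

The operators have to satisfy the relations of the covering group, with `z` acting by `-1`. On the
vectors `1 ⊗ b` the two sides of a relation agree, as the relation holds in `ℂW^{e-}`. These vectors
generate the space under the `ξ_k`, so that it suffices to see that the two sides are moved past the
`ξ_k` by one and the same formula (`SameCross.eq`). For each relation this is a computation with the
rules of the generators (`wordUnit_eq_of_coverRel`). Besides the rules, it
uses only that `t_i² = 1` and, in two relations, the values of the `t_{π_r}²`.

Since the cross relations hold by construction, `Ḧ^-_W` acts (`heckeAction`). The map
`h ↦ h · (1 ⊗ 1)` sends `a b` to `a ⊗ b`, and is a left inverse of multiplication. It is also a right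
inverse, because multiplication `𝒞[ξ] ⊗ ℂW^{e-} → Ḧ^-_W` is `Ḧ^-_W`-equivariant
(`mulMap_heckeAction`), which again needs to be tested on the generators only.
-/

namespace SpinDAHA

noncomputable section

/-! ### Twisted commutation relations -/

section Cross

variable {I E : Type*} [Ring E] [Algebra ℂ E]

/-- The element `T` can be moved to the right of every `x k`, at the cost of permuting the `x k`
by `s`, multiplying by the scalar `ε`, and adding the scalar `c k`. -/
def Cross (x : I → E) (T : E) (s : I → I) (ε : ℂ) (c : I → ℂ) : Prop :=
  ∀ k, T * x k = ε • (x (s k) * T) + c k • 1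

/-- The elements `f` and `g` are moved to the right of every `x k` by formulas with the same
coefficients. Then `f - g` commutes with the `x k` up to a twist, which is why `f = g` follows as
soon as `f` and `g` agree on a set generating the module under the `x k`. -/
def SameCross (x : I → E) (f g : E) : Prop :=
  ∀ k, ∃ y z, f * x k = y * f + z ∧ g * x k = y * g + z

variable {x : I → E} {P P' Q T T₁ T₂ : E} {p p' q s s₁ s₂ : I → I} {ε ε' δ ζ : ℂ}
  {c c' c₁ c₂ : I → ℂ}

theorem Cross.mul_assoc' (h : Cross x T s ε c) (k : I) (w : E) :
    T * (x k * w) = ε • (x (s k) * (T * w)) + c k • w := by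
  rw [← mul_assoc, h k, add_mul, smul_mul_assoc, smul_mul_assoc, one_mul, mul_assoc]

theorem Cross.zero_apply (h : Cross x P p ε 0) (k : I) : P * x k = ε • (x (p k) * P) := by
  rw [h k, Pi.zero_apply, zero_smul, add_zero]

theorem Cross.zero_assoc (h : Cross x P p ε 0) (k : I) (w : E) :
    P * (x k * w) = ε • (x (p k) * (P * w)) := by
  rw [← mul_assoc, h.zero_apply k, smul_mul_assoc, mul_assoc]

theorem Cross.mul (h : Cross x P p ε 0) (h' : Cross x P' p' ε' 0) :
    Cross x (P * P') (p ∘ p') (ε * ε') 0 := by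
  intro k
  rw [mul_assoc, h'.zero_apply, mul_smul_comm, h.zero_assoc, smul_smul, mul_comm ε' ε,
    Pi.zero_apply, zero_smul, add_zero, Function.comp_apply]

theorem Cross.one (x : I → E) : Cross x (1 : E) id 1 0 := by
  intro k
  simp

theorem Cross.pow (h : Cross x P p ε 0) (m : ℕ) : Cross x (P ^ m) p^[m] (ε ^ m) 0 := by
  induction m with
  | zero => simpa using Cross.one x
  | succ m ih => simpa only [pow_succ, Function.iterate_succ] using ih.mul h

theorem Cross.sameCross (h : Cross x P p ε c) (h' : Cross x P' p' ε' c) (hp : ∀ k, p k = p' k)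
    (hε : ε = ε') : SameCross x P P' := by
  intro k
  refine ⟨ε • x (p k), c k • 1, ?_, ?_⟩
  · rw [h k, smul_mul_assoc]
  · rw [h' k, smul_mul_assoc, hp, hε]

/-- The case of the relation `P T₁ = ζ T₂ P`, where `P` has no additive term. -/
theorem Cross.slide (hP : Cross x P p ε 0) (h₁ : Cross x T₁ s₁ δ c₁) (h₂ : Cross x T₂ s₂ δ c₂)
    (hs : ∀ k, p (s₁ k) = s₂ (p k)) (hc : ∀ k, c₁ k = ζ * ε * c₂ (p k)) :
    SameCross x (P * T₁) (ζ • (T₂ * P)) := by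
  intro k
  refine ⟨(δ * ε) • x (p (s₁ k)), c₁ k • P, ?_, ?_⟩
  · rw [mul_assoc, h₁ k, mul_add, mul_smul_comm, hP.zero_assoc, mul_smul_comm, mul_one, smul_smul,
      smul_mul_assoc]
  · rw [smul_mul_assoc, mul_assoc, hP.zero_apply, mul_smul_comm, h₂.mul_assoc', hs, hc]
    simp only [smul_mul_assoc, mul_smul_comm]
    module

theorem Cross.sameCross_sq_one (h : Cross x T s (-1) c) (hs : ∀ k, s (s k) = k)
    (hc : ∀ k, c (s k) = c k) : SameCross x (T * T) 1 := by
  intro k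
  refine ⟨x k, 0, ?_, by simp⟩
  rw [mul_assoc, h k, mul_add, mul_smul_comm, h.mul_assoc', hs, hc, mul_smul_comm, mul_one]
  module

/-- The case of the relation `(T₁ T₂)² = -1`, in the form `T₁ T₂ = -T₂ T₁`. -/
theorem Cross.sameCross_two (h₁ : Cross x T₁ s₁ (-1) c₁) (h₂ : Cross x T₂ s₂ (-1) c₂)
    (hs : ∀ k, s₁ (s₂ k) = s₂ (s₁ k)) (hc₁ : ∀ k, c₁ (s₂ k) = c₁ k)
    (hc₂ : ∀ k, c₂ (s₁ k) = c₂ k) :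
    SameCross x (T₁ * T₂) (-(T₂ * T₁)) := by
  intro k
  refine ⟨x (s₁ (s₂ k)), c₂ k • T₁ - c₁ k • T₂, ?_, ?_⟩
  · rw [mul_assoc, h₂ k, mul_add, mul_smul_comm, h₁.mul_assoc', hc₁, mul_smul_comm, mul_one]
    module
  · rw [neg_mul, mul_assoc, h₁ k, mul_add, mul_smul_comm, h₂.mul_assoc', hc₂, mul_smul_comm,
      mul_one, hs, mul_neg]
    module

theorem Cross.mul_mul_mul (h₁ : Cross x T₁ s₁ (-1) c₁) (h₂ : Cross x T₂ s₂ (-1) c₂)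
    (hT₁ : T₁ * T₁ = 1) (k : I) :
    T₁ * T₂ * T₁ * x k = -x (s₁ (s₂ (s₁ k))) * (T₁ * T₂ * T₁) +
      (c₁ (s₂ (s₁ k)) • (T₂ * T₁) - c₂ (s₁ k) • 1 + c₁ k • (T₁ * T₂)) := by
  simp only [mul_assoc, h₁ k, h₂.mul_assoc', h₁.mul_assoc', mul_add, mul_smul_comm, mul_one, hT₁,
    neg_mul]
  module

/-- The case of the braid relation `T₁ T₂ T₁ = T₂ T₁ T₂`. The additive terms of the two sides are
compared by means of `T₁² = T₂² = 1` only. -/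
theorem Cross.sameCross_three (h₁ : Cross x T₁ s₁ (-1) c₁) (h₂ : Cross x T₂ s₂ (-1) c₂)
    (hT₁ : T₁ * T₁ = 1) (hT₂ : T₂ * T₂ = 1)
    (hs : ∀ k, s₁ (s₂ (s₁ k)) = s₂ (s₁ (s₂ k))) (hc₁ : ∀ k, c₁ (s₂ (s₁ k)) = c₂ k)
    (hc₂ : ∀ k, c₂ (s₁ (s₂ k)) = c₁ k) (hc : ∀ k, c₁ (s₂ k) = c₂ (s₁ k)) :
    SameCross x (T₁ * T₂ * T₁) (T₂ * T₁ * T₂) := by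
  intro k
  refine ⟨_, _, h₁.mul_mul_mul h₂ hT₁ k, ?_⟩
  rw [h₂.mul_mul_mul h₁ hT₂ k, hs, hc₁, hc₂, hc]
  abel

theorem Cross.mul_mul_mul_mul (h₁ : Cross x T₁ s₁ (-1) c₁) (h₂ : Cross x T₂ s₂ (-1) c₂)
    (hT₁ : T₁ * T₁ = 1) (hT₂ : T₂ * T₂ = 1) (k : I) :
    T₁ * T₂ * T₁ * T₂ * x k = x (s₁ (s₂ (s₁ (s₂ k)))) * (T₁ * T₂ * T₁ * T₂) +
      (c₂ k • (T₁ * T₂ * T₁) - c₁ (s₂ k) • T₁ + c₂ (s₁ (s₂ k)) • T₂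
        - c₁ (s₂ (s₁ (s₂ k))) • (T₂ * T₁ * T₂)) := by
  have hT₁' (w : E) : T₁ * (T₁ * w) = w := by rw [← mul_assoc, hT₁, one_mul]
  simp only [mul_assoc, h₂ k, h₂.mul_assoc', h₁.mul_assoc', mul_add, mul_smul_comm, mul_one, hT₂,
    hT₁']
  module

/-- The case of the relation `(T₁ T₂)⁴ = -1`, in the form `T₁ T₂ T₁ T₂ = -T₂ T₁ T₂ T₁`. -/
theorem Cross.sameCross_four (h₁ : Cross x T₁ s₁ (-1) c₁) (h₂ : Cross x T₂ s₂ (-1) c₂)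
    (hT₁ : T₁ * T₁ = 1) (hT₂ : T₂ * T₂ = 1)
    (hs : ∀ k, s₁ (s₂ (s₁ (s₂ k))) = s₂ (s₁ (s₂ (s₁ k))))
    (hc₁ : ∀ k, c₁ (s₂ (s₁ (s₂ k))) = c₁ k) (hc₂ : ∀ k, c₂ (s₁ (s₂ (s₁ k))) = c₂ k)
    (hc₁' : ∀ k, c₁ (s₂ (s₁ k)) = c₁ (s₂ k)) (hc₂' : ∀ k, c₂ (s₁ (s₂ k)) = c₂ (s₁ k)) :
    SameCross x (T₁ * T₂ * T₁ * T₂) (-(T₂ * T₁ * T₂ * T₁)) := by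
  intro k
  refine ⟨_, _, h₁.mul_mul_mul_mul h₂ hT₁ hT₂ k, ?_⟩
  rw [neg_mul, h₂.mul_mul_mul_mul h₁ hT₂ hT₁ k, hs, hc₁, hc₂, hc₁', hc₂', mul_neg]
  abel

/-- The case of the relation `P T P T = -T P T P` of type `B`. -/
theorem Cross.sameCross_braid (hP : Cross x P id (-1) 0) (h : Cross x T s (-1) c)
    (hPP : P * P = 1) (hs : ∀ k, s (s k) = k) (hc : ∀ k, c (s k) = c k) :
    SameCross x (P * T * P * T) (-(T * P * T * P)) := by
  intro k
  have hPP' (w : E) : P * (P * w) = w := by rw [← mul_assoc, hPP, one_mul]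
  refine ⟨x k, c k • T + c k • (P * T * P), ?_, ?_⟩
  · simp only [mul_assoc, h k, h.mul_assoc', hP.zero_assoc, mul_add, mul_smul_comm,
      mul_one, hs, hc, id, hPP']
    module
  · simp only [mul_assoc, h.mul_assoc', hP.zero_assoc, hP.zero_apply, mul_add, mul_smul_comm,
      mul_one, hs, hc, id, hPP, neg_mul, mul_neg]
    module

/-- The case of the relation `P T₁ P = -Q T₂ Q` of type `D` with `n` even. The additive terms agree
because `P²` and `-δ Q²` are both `1`. -/
theorem Cross.sameCross_conj (hP : Cross x P id 1 0) (hQ : Cross x Q q δ 0)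
    (h₁ : Cross x T₁ s₁ ε c₁) (h₂ : Cross x T₂ s₂ ε c₂) (hPP : P * P = 1) (hQQ : Q * Q = (-δ) • 1)
    (hδ : δ * δ = 1) (hs : ∀ k, q (s₂ (q k)) = s₁ k) (hc : ∀ k, c₂ (q k) = c₁ k) :
    SameCross x (P * T₁ * P) (-(Q * T₂ * Q)) := by
  intro k
  refine ⟨ε • x (s₁ k), c₁ k • 1, ?_, ?_⟩
  · simp only [mul_assoc, h₁.mul_assoc', hP.zero_assoc, hP.zero_apply, mul_add, mul_smul_comm,
      id, hPP, smul_mul_assoc]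
    module
  · simp only [mul_assoc, h₂.mul_assoc', hQ.zero_assoc, hQ.zero_apply, mul_add, mul_smul_comm,
      smul_mul_assoc, neg_mul, mul_neg, hs, hc, hQQ, smul_smul, smul_add, neg_smul, smul_neg]
    rw [show δ * (c₁ k * δ) = c₁ k by linear_combination c₁ k * hδ,
      show δ * (ε * δ) = ε by linear_combination ε * hδ]
    module

end Cross

/-! ### The skew-polynomial algebra -/

section Skew

variable {n : ℕ}

variable (n) in
/-- The quotient map from the free algebra onto `𝒞[ξ]`. -/
def Skew.mk : FreeAlgebra ℂ (Idx n) →ₐ[ℂ] Skew n := RingQuot.mkAlgHom ℂ (SkewRel n)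

theorem Skew.mk_ι (i : Idx n) : Skew.mk n (FreeAlgebra.ι ℂ i) = Skew.ξ i := rfl

theorem Skew.ξ_mul_ξ_add {i j : Idx n} (h : i ≠ j) :
    Skew.ξ i * Skew.ξ j + Skew.ξ j * Skew.ξ i = 0 := by
  have : Skew.mk n _ = Skew.mk n _ := RingQuot.mkAlgHom_rel ℂ (SkewRel.anticomm i j h)
  simpa only [map_add, map_mul, map_zero, Skew.mk_ι] using this

/-- The homomorphism out of `𝒞[ξ]` determined by a family with `f_i f_j + f_j f_i = 0`. -/
def Skew.lift {B : Type*} [Ring B] [Algebra ℂ B] (f : Idx n → B)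
    (hf : ∀ i j, i ≠ j → f i * f j + f j * f i = 0) : Skew n →ₐ[ℂ] B :=
  RingQuot.liftAlgHom ℂ ⟨FreeAlgebra.lift ℂ f, by
    rintro _ _ ⟨i, j, h⟩
    simpa using hf i j h⟩

theorem Skew.lift_ξ {B : Type*} [Ring B] [Algebra ℂ B] (f : Idx n → B)
    (hf : ∀ i j, i ≠ j → f i * f j + f j * f i = 0) (i : Idx n) :
    Skew.lift f hf (Skew.ξ i) = f i := by
  refine (RingQuot.liftAlgHom_mkAlgHom_apply ℂ _ _ _).trans ?_
  simp

/-- `𝒞[ξ]` is spanned by the products `ξ_{i₁} ⋯ ξ_{iₘ}`. -/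
theorem Skew.induction {p : Skew n → Prop} (one : p 1)
    (add : ∀ a b, p a → p b → p (a + b)) (smul : ∀ (c : ℂ) a, p a → p (c • a))
    (ξ_mul : ∀ i a, p a → p (Skew.ξ i * a)) (a : Skew n) : p a := by
  have key (f : FreeAlgebra ℂ (Idx n)) :
      ∀ b, p b → p (Skew.mk n f * b) := by
    induction f using FreeAlgebra.induction with
    | grade0 r =>
      intro b hb
      rw [AlgHom.commutes, ← Algebra.smul_def]
      exact smul r b hb
    | grade1 i => exact ξ_mul i
    | mul f g hf hg =>
      intro b hb
      rw [map_mul, mul_assoc]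
      exact hf _ (hg b hb)
    | add f g hf hg =>
      intro b hb
      rw [map_add, add_mul]
      exact add _ _ (hf b hb) (hg b hb)
  obtain ⟨f, rfl⟩ := RingQuot.mkAlgHom_surjective ℂ (SkewRel n) a
  have h := key f 1 one
  rwa [mul_one] at h

end Skew

/-! ### Operators on `𝒞[ξ] ⊗ V` -/

section Operators

variable (n : ℕ) (V : Type*) [Ring V] [Algebra ℂ V]

/-- Left multiplication of `𝒞[ξ]` on the first factor of `𝒞[ξ] ⊗ V`. -/
def leftMul : Skew n →ₐ[ℂ] Module.End ℂ (Skew n ⊗[ℂ] V) :=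
  (Algebra.lmul ℂ (Skew n ⊗[ℂ] V)).comp Algebra.TensorProduct.includeLeft

/-- The operator of multiplication by `ξ_k` on the first factor of `𝒞[ξ] ⊗ V`. -/
def mulξ (k : Idx n) : Module.End ℂ (Skew n ⊗[ℂ] V) := leftMul n V (Skew.ξ k)

variable {n V}

theorem leftMul_tmul (a a' : Skew n) (b : V) :
    leftMul n V a (a' ⊗ₜ[ℂ] b) = (a * a') ⊗ₜ[ℂ] b := by
  simp [leftMul]

theorem mulξ_tmul (k : Idx n) (a : Skew n) (b : V) :
    mulξ n V k (a ⊗ₜ[ℂ] b) = (Skew.ξ k * a) ⊗ₜ[ℂ] b := leftMul_tmul _ _ _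

theorem mulξ_mul_add {k l : Idx n} (h : k ≠ l) :
    mulξ n V k * mulξ n V l + mulξ n V l * mulξ n V k = 0 := by
  rw [mulξ, mulξ, ← map_mul, ← map_mul, ← map_add, Skew.ξ_mul_ξ_add h, map_zero]

/-- The vectors `1 ⊗ b` generate `𝒞[ξ] ⊗ V` under the operators `ξ_k`. -/
theorem eq_of_tmul_one_of_mulξ {N : Type*} [AddCommGroup N] [Module ℂ N]
    {f g : (Skew n ⊗[ℂ] V) →ₗ[ℂ] N} (one : ∀ b, f (1 ⊗ₜ b) = g (1 ⊗ₜ b))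
    (step : ∀ k m, f m = g m → f (mulξ n V k m) = g (mulξ n V k m)) : f = g := by
  refine TensorProduct.ext' fun a b => ?_
  induction a using Skew.induction with
  | one => exact one b
  | add a a' h h' => rw [TensorProduct.add_tmul, map_add, map_add, h, h']
  | smul c a h => rw [← TensorProduct.smul_tmul', map_smul, map_smul, h]
  | ξ_mul k a h =>
    rw [← mulξ_tmul]
    exact step k _ h

/-- The test by which all relations between operators on `𝒞[ξ] ⊗ V` are verified. -/
theorem SameCross.eq {f g : Module.End ℂ (Skew n ⊗[ℂ] V)} (h : SameCross (mulξ n V) f g)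
    (one : ∀ b, f (1 ⊗ₜ b) = g (1 ⊗ₜ b)) : f = g := by
  refine eq_of_tmul_one_of_mulξ one fun k m hm => ?_
  obtain ⟨y, z, hf, hg⟩ := h k
  have hf' := LinearMap.congr_fun hf m
  have hg' := LinearMap.congr_fun hg m
  simp only [Module.End.mul_apply, LinearMap.add_apply] at hf' hg'
  rw [hf', hg', hm]

variable (n) in
/-- The coefficients of a commutation rule `T ξ_k = ε ξ_{s k} T + c_k`, subject to the condition
under which the rule is compatible with the relations `ξ_k ξ_l + ξ_l ξ_k = 0`. -/
structure Twist where
  /-- The permutation `s` of the variables. -/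
  perm : Equiv.Perm (Idx n)
  /-- The scalar `ε`. -/
  sign : ℂ
  /-- The scalars `c_k`. -/
  shift : Idx n → ℂ
  /-- The additive terms of `T (ξ_k ξ_l + ξ_l ξ_k)` cancel. -/
  compat : ∀ k l, k ≠ l → shift k • (Skew.ξ l + sign • Skew.ξ (perm l)) +
    shift l • (Skew.ξ k + sign • Skew.ξ (perm k)) = 0

/-- The action of `𝒞[ξ]` on pairs by which a commutation rule is extended from the `ξ_k` to all
skew polynomials: `a` acts by a triangular matrix with diagonal `(σ a, a)` and corner `D a`, where
`σ` is the automorphism `ξ_k ↦ ε ξ_{s k}` and `D` the `σ`-derivation `ξ_k ↦ c_k`. -/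
def Twist.pairHom (τ : Twist n) (V : Type*) [Ring V] [Algebra ℂ V] :
    Skew n →ₐ[ℂ] Module.End ℂ ((Skew n ⊗[ℂ] V) × (Skew n ⊗[ℂ] V)) :=
  Skew.lift
    (fun k => ((τ.sign • mulξ n V (τ.perm k)) ∘ₗ LinearMap.fst ℂ _ _ +
      τ.shift k • LinearMap.snd ℂ _ _).prod (mulξ n V k ∘ₗ LinearMap.snd ℂ _ _))
    (fun k l h => by
      refine LinearMap.ext fun ⟨m, m'⟩ => ?_
      have h₁ := LinearMap.congr_fun (mulξ_mul_add (V := V) (τ.perm.injective.ne h)) m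
      have h₂ := LinearMap.congr_fun (mulξ_mul_add (V := V) h) m'
      have h₃ := LinearMap.congr_fun (congrArg (leftMul n V) (τ.compat k l h)) m'
      simp only [map_add, map_smul, map_zero, LinearMap.add_apply, LinearMap.smul_apply,
        LinearMap.zero_apply, Module.End.mul_apply] at h₁ h₂ h₃
      change τ.shift k • (mulξ n V l m' + τ.sign • mulξ n V (τ.perm l) m') +
        τ.shift l • (mulξ n V k m' + τ.sign • mulξ n V (τ.perm k) m') = 0 at h₃
      refine Prod.ext ?_ ?_
      · change τ.sign • mulξ n V (τ.perm k) (τ.sign • mulξ n V (τ.perm l) m + τ.shift l • m') +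
          τ.shift k • mulξ n V l m' +
          (τ.sign • mulξ n V (τ.perm l) (τ.sign • mulξ n V (τ.perm k) m + τ.shift k • m') +
          τ.shift l • mulξ n V k m') = 0
        simp only [map_add, map_smul]
        linear_combination (norm := module) (τ.sign * τ.sign) • h₁ + h₃
      · simpa using h₂)

theorem Twist.pairHom_ξ_apply (τ : Twist n) (k : Idx n)
    (m : (Skew n ⊗[ℂ] V) × (Skew n ⊗[ℂ] V)) :
    τ.pairHom V (Skew.ξ k) m =
      (τ.sign • mulξ n V (τ.perm k) m.1 + τ.shift k • m.2, mulξ n V k m.2) := by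
  rw [Twist.pairHom, Skew.lift_ξ]
  rfl

/-- The second diagonal entry of the triangular matrix attached to `a` is `a` itself. -/
theorem Twist.pairHom_apply_snd (τ : Twist n) (a : Skew n)
    (m : (Skew n ⊗[ℂ] V) × (Skew n ⊗[ℂ] V)) :
    (τ.pairHom V a m).2 = leftMul n V a m.2 := by
  induction a using Skew.induction with
  | one => simp
  | add a b ha hb => simp [ha, hb]
  | smul c a ha => simp [ha]
  | ξ_mul k a ha =>
    rw [map_mul, map_mul, Module.End.mul_apply, Module.End.mul_apply, pairHom_ξ_apply, ha]
    rfl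

/-- The operator on `𝒞[ξ] ⊗ V` that obeys the commutation rule `τ` with the `ξ_k` and sends
`1 ⊗ b` to `1 ⊗ g b`. -/
def Twist.op (τ : Twist n) (g : V) : Module.End ℂ (Skew n ⊗[ℂ] V) :=
  TensorProduct.lift (LinearMap.mk₂ ℂ
    (fun a b => (τ.pairHom V a (1 ⊗ₜ (g * b), 1 ⊗ₜ b)).1)
    (fun a a' b => by simp)
    (fun c a b => by simp)
    (fun a b b' => by
      rw [mul_add, TensorProduct.tmul_add, TensorProduct.tmul_add, ← Prod.mk_add_mk, map_add,
        Prod.fst_add])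
    (fun c a b => by
      rw [mul_smul_comm, TensorProduct.tmul_smul, TensorProduct.tmul_smul, ← Prod.smul_mk,
        map_smul, Prod.smul_fst]))

theorem Twist.op_tmul (τ : Twist n) (g : V) (a : Skew n) (b : V) :
    τ.op g (a ⊗ₜ b) = (τ.pairHom V a (1 ⊗ₜ (g * b), 1 ⊗ₜ b)).1 := rfl

theorem Twist.op_one_tmul (τ : Twist n) (g b : V) : τ.op g (1 ⊗ₜ b) = 1 ⊗ₜ (g * b) := by
  rw [op_tmul, map_one, Module.End.one_apply]

theorem Twist.cross_op (τ : Twist n) (g : V) :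
    Cross (mulξ n V) (τ.op g) τ.perm τ.sign τ.shift := by
  intro k
  refine TensorProduct.ext' fun a b => ?_
  rw [Module.End.mul_apply, mulξ_tmul, op_tmul, map_mul, Module.End.mul_apply, pairHom_ξ_apply,
    pairHom_apply_snd, leftMul_tmul, mul_one]
  rfl

end Operators

/-! ### The commutation rules of the generators -/

section Twists

variable {n : ℕ}

/-- The rule `T ξ_k = -ξ_{s k} T + c_k` with `s` the transposition of `a` and `b`, and `c_k = w`
for `k = a, b` and `c_k = 0` otherwise. The case `a = b` is allowed. -/
def Twist.ofSwap (a b : Idx n) (w : ℂ) : Twist n where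
  perm := Equiv.swap a b
  sign := -1
  shift k := if k = a ∨ k = b then w else 0
  compat k l h := by
    simp only [Equiv.swap_apply_def]
    split_ifs <;> subst_vars <;> simp_all

theorem Twist.shift_swap (a b k : Idx n) (w : ℂ) :
    (ofSwap a b w).shift (Equiv.swap a b k) = (ofSwap a b w).shift k := by
  simp only [ofSwap, Equiv.swap_apply_def]
  grind

/-- The rule `P ξ_k = ε ξ_{p k} P`. -/
def Twist.ofPerm (p : Equiv.Perm (Idx n)) (ε : ℂ) : Twist n where
  perm := p
  sign := ε
  shift := 0
  compat := by simp

section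

variable {V : Type*} [Ring V] [Algebra ℂ V]

theorem Twist.cross_op_ofPerm (p : Equiv.Perm (Idx n)) (ε : ℂ) (g : V) :
    Cross (mulξ n V) ((ofPerm p ε).op g) p ε 0 := cross_op _ _

theorem Twist.op_ofPerm_mul_op_ofPerm {p q : Equiv.Perm (Idx n)} {ε δ : ℂ} {g h : V}
    (hpq : p * q = 1) (hε : ε * δ = 1) (hg : g * h = 1) :
    (ofPerm p ε).op g * (ofPerm q δ).op h = 1 := by
  refine SameCross.eq (((cross_op_ofPerm p ε g).mul (cross_op_ofPerm q δ h)).sameCross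
    (Cross.one _) (fun k => congrArg (· k) hpq) hε) fun b => ?_
  rw [Module.End.mul_apply, op_one_tmul, op_one_tmul, ← mul_assoc, hg, one_mul,
    Module.End.one_apply]

theorem Twist.op_ofSwap_mul_self (a b : Idx n) (w : ℂ) {g : V} (hg : g * g = 1) :
    (ofSwap a b w).op g * (ofSwap a b w).op g = 1 := by
  refine SameCross.eq ((cross_op (ofSwap a b w) g).sameCross_sq_one
    (Equiv.swap_apply_self a b) fun k => shift_swap a b k w) fun b => ?_
  rw [Module.End.mul_apply, op_one_tmul, op_one_tmul, ← mul_assoc, hg, one_mul,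
    Module.End.one_apply]

end

section

variable {E : Type*} [Ring E] [Algebra ℂ E] {x : Idx n → E} {P T T₁ T₂ : E} {p : Idx n → Idx n}
  {a b a' b' : Idx n} {w : ℂ} {ε ζ : ℂ}

/-- `T` obeys the commutation rule `τ` with the `x k`. -/
abbrev Twist.Rule (τ : Twist n) (x : Idx n → E) (T : E) : Prop :=
  Cross x T τ.perm τ.sign τ.shift

theorem Twist.Rule.slide (hP : Cross x P p ε 0) (hp : p.Injective)
    (h₁ : (ofSwap a b w).Rule x T₁) (h₂ : (ofSwap a' b' w).Rule x T₂)
    (hab : p a = a' ∧ p b = b' ∨ p a = b' ∧ p b = a') (hζ : ζ * ε = 1) :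
    SameCross x (P * T₁) (ζ • (T₂ * P)) := by
  have hk (k l : Idx n) : p k = p l ↔ k = l := hp.eq_iff
  refine Cross.slide hP h₁ h₂ (fun k => ?_) fun k => ?_
  · simp only [ofSwap, Equiv.swap_apply_def]
    grind
  · simp only [ofSwap, hζ, one_mul]
    grind

theorem Twist.Rule.sameCross_two {w' : ℂ} (h₁ : (ofSwap a b w).Rule x T₁)
    (h₂ : (ofSwap a' b' w').Rule x T₂)
    (h : (a ≠ a' ∧ a ≠ b' ∧ b ≠ a' ∧ b ≠ b') ∨ (a = a' ∧ b = b')) :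
    SameCross x (T₁ * T₂) (-(T₂ * T₁)) := by
  refine Cross.sameCross_two h₁ h₂ (fun k => ?_) (fun k => ?_) fun k => ?_ <;>
  · simp only [ofSwap, Equiv.swap_apply_def]
    grind

theorem Twist.Rule.sameCross_three (h₁ : (ofSwap a b w).Rule x T₁)
    (h₂ : (ofSwap a' b' w).Rule x T₂) (hT₁ : T₁ * T₁ = 1) (hT₂ : T₂ * T₂ = 1)
    (hab : a ≠ b) (hab' : a' ≠ b') (h : (b = a' ∧ a ≠ b') ∨ (b' = a ∧ a' ≠ b)) :
    SameCross x (T₁ * T₂ * T₁) (T₂ * T₁ * T₂) := by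
  refine Cross.sameCross_three h₁ h₂ hT₁ hT₂ (fun k => ?_) (fun k => ?_) (fun k => ?_)
    fun k => ?_ <;>
  · simp only [ofSwap, Equiv.swap_apply_def]
    grind

theorem Twist.Rule.sameCross_four {w' : ℂ} (h₁ : (ofSwap a b w).Rule x T₁)
    (h₂ : (ofSwap a' b' w').Rule x T₂) (hT₁ : T₁ * T₁ = 1) (hT₂ : T₂ * T₂ = 1)
    (hab : (a = b ∧ b' = a) ∨ (a' = b' ∧ b = a')) :
    SameCross x (T₁ * T₂ * T₁ * T₂) (-(T₂ * T₁ * T₂ * T₁)) := by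
  refine Cross.sameCross_four h₁ h₂ hT₁ hT₂ (fun k => ?_) (fun k => ?_) (fun k => ?_)
    (fun k => ?_) fun k => ?_ <;>
  · simp only [ofSwap, Equiv.swap_apply_def]
    grind

end

/-- The cyclic permutation `k ↦ k + 1` of `{1, …, n}`. -/
def rotate (n : ℕ) : Equiv.Perm (Idx n) where
  toFun k := if h : (k : ℕ) = n then ⟨1, by grind⟩ else ⟨k + 1, by grind⟩
  invFun k := if h : (k : ℕ) = 1 then ⟨n, by grind⟩ else ⟨k - 1, by grind⟩
  left_inv k := by grind
  right_inv k := by grind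

theorem rotate_coe (k : Idx n) : (rotate n k : ℕ) = if (k : ℕ) = n then 1 else (k : ℕ) + 1 := by
  simp only [rotate, Equiv.coe_fn_mk]
  split_ifs <;> rfl

theorem rotate_iterate_coe (k : Idx n) (m : ℕ) (hm : m ≤ n) :
    ((rotate n)^[m] k : ℕ) = if (k : ℕ) + m ≤ n then (k : ℕ) + m else k + m - n := by
  induction m with
  | zero =>
    rw [Function.iterate_zero_apply]
    grind
  | succ m ih =>
    rw [Function.iterate_succ_apply', rotate_coe, ih (by omega)]
    grind

theorem rotate_iterate_self (k : Idx n) : (rotate n)^[n] k = k := by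
  refine Subtype.ext ?_
  rw [rotate_iterate_coe k n le_rfl]
  grind

/-- The reversal `k ↦ n + 1 - k` of `{1, …, n}`. -/
def reverse (n : ℕ) : Equiv.Perm (Idx n) where
  toFun k := ⟨n + 1 - k, by grind⟩
  invFun k := ⟨n + 1 - k, by grind⟩
  left_inv k := by grind
  right_inv k := by grind

theorem reverse_coe (k : Idx n) : (reverse n k : ℕ) = n + 1 - k := rfl

theorem reverse_reverse (k : Idx n) : reverse n (reverse n k) = k :=
  (reverse n).left_inv k

/-- The smaller of the two indices of variables moved by the node `i` (the node `n` of `B_n`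
fixes all indices; for it, both are set to `n`). -/
def loVal : ClassicalType → ℕ → ℕ → ℕ
  | .A, _, i => i
  | .B, _, i => i
  | .D, n, i => if i = n then n - 1 else i

/-- The larger of the two indices of variables moved by the node `i`. -/
def hiVal : ClassicalType → ℕ → ℕ → ℕ
  | .A, _, i => i + 1
  | .B, n, i => if i = n then n else i + 1
  | .D, n, i => if i = n then n else i + 1

/-- The parameter attached to the node `i`. -/
def nodeParam (u v : ℂ) : ClassicalType → ℕ → ℕ → ℂ
  | .A, _, _ => u
  | .B, n, i => if i = n then v else u
  | .D, _, _ => u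

variable {X : ClassicalType}

/-- `loVal` as an index of a variable. -/
def nodeLo (hn : Admissible X n) (i : Idx (rank X n)) : Idx n :=
  ⟨loVal X n i, by
    obtain ⟨i, hi⟩ := i
    cases X <;> grind [Admissible, rank, loVal]⟩

/-- `hiVal` as an index of a variable. -/
def nodeHi (hn : Admissible X n) (i : Idx (rank X n)) : Idx n :=
  ⟨hiVal X n i, by
    obtain ⟨i, hi⟩ := i
    cases X <;> grind [Admissible, rank, hiVal]⟩

/-- The commutation rule of `t_i`. -/
def nodeTwist (u v : ℂ) (hn : Admissible X n) (i : Idx (rank X n)) : Twist n :=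
  Twist.ofSwap (nodeLo hn i) (nodeHi hn i) (nodeParam u v X n i)

/-- The permutation and the sign in the commutation rule of `t_{π_r}`. For odd `n`, the exponent
`n / 2` is `(n - 1) / 2`. -/
def piData : (X : ClassicalType) → (n : ℕ) → PiIdx X n → Equiv.Perm (Idx n) × ℕ
  | .A, n, _ => (rotate n, n - 1)
  | .B, _, _ => (1, 1)
  | .D, n, r => if (r : ℕ) = n then (reverse n, n / 2) else (1, 0)

/-- The commutation rule of `t_{π_r}`. -/
def piTwist (r : PiIdx X n) : Twist n :=
  Twist.ofPerm (piData X n r).1 ((-1) ^ (piData X n r).2)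

/-- The commutation rule of `t_{π_r}⁻¹`. -/
def piTwistInv (r : PiIdx X n) : Twist n :=
  Twist.ofPerm (piData X n r).1⁻¹ ((-1) ^ (piData X n r).2)

theorem coxeterM_eq_one {i j : Idx (rank X n)} (h : coxeterM X n i j = 1) : i = j := by
  cases X <;> simp only [coxeterM] at h <;> grind

/-- Nodes with Coxeter integer `2` move disjoint sets of variables, or the same variables (the
nodes `n - 1` and `n` of `D_n`). -/
theorem coxeterM_two (hn : Admissible X n) {i j : Idx (rank X n)} (h : coxeterM X n i j = 2) :
    (nodeLo hn i ≠ nodeLo hn j ∧ nodeLo hn i ≠ nodeHi hn j ∧ nodeHi hn i ≠ nodeLo hn j ∧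
      nodeHi hn i ≠ nodeHi hn j) ∨ (nodeLo hn i = nodeLo hn j ∧ nodeHi hn i = nodeHi hn j) := by
  obtain ⟨i, hi⟩ := i
  obtain ⟨j, hj⟩ := j
  cases X <;> simp only [nodeLo, nodeHi, Subtype.mk.injEq, ne_eq] <;>
    grind [coxeterM, loVal, hiVal, Admissible, rank, nodeParam]

/-- Nodes with Coxeter integer `3` have the same parameter, and the transpositions attached to them
have exactly one index in common. -/
theorem coxeterM_three (hn : Admissible X n) {i j : Idx (rank X n)}
    (h : coxeterM X n i j = 3) (u v : ℂ) :
    nodeParam u v X n i = nodeParam u v X n j ∧ nodeLo hn i ≠ nodeHi hn i ∧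
      nodeLo hn j ≠ nodeHi hn j ∧ ((nodeHi hn i = nodeLo hn j ∧ nodeLo hn i ≠ nodeHi hn j) ∨
        (nodeHi hn j = nodeLo hn i ∧ nodeLo hn j ≠ nodeHi hn i)) := by
  obtain ⟨i, hi⟩ := i
  obtain ⟨j, hj⟩ := j
  cases X <;> simp only [nodeLo, nodeHi, Subtype.mk.injEq, ne_eq] <;>
    grind [coxeterM, loVal, hiVal, Admissible, rank, nodeParam]

/-- Of two nodes with Coxeter integer `4`, one is the node `n` of `B_n`, which fixes all indices,
and the other is the node `n - 1`. -/
theorem coxeterM_four (hn : Admissible X n) {i j : Idx (rank X n)}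
    (h : coxeterM X n i j = 4) :
    (nodeLo hn i = nodeHi hn i ∧ nodeHi hn j = nodeLo hn i) ∨
      (nodeLo hn j = nodeHi hn j ∧ nodeHi hn i = nodeLo hn j) := by
  obtain ⟨i, hi⟩ := i
  obtain ⟨j, hj⟩ := j
  cases X <;> simp only [nodeLo, nodeHi, Subtype.mk.injEq] <;>
    grind [coxeterM, loVal, hiVal, Admissible, rank, nodeParam]

end Twists

/-! ### The spin extended affine Weyl group algebra -/

section SpinWeyl

/-- The image of the covering group in the spin group algebra. -/
def SpinWeyl.ofCover (X : ClassicalType) (n : ℕ) : Cover X n →* SpinWeyl X n :=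
  (SpinWeyl.mk X n : MonoidAlgebra ℂ (Cover X n) →* SpinWeyl X n).comp
    (MonoidAlgebra.of ℂ (Cover X n))

/-- The evaluation of a word in the generators of the covering group. -/
def SpinWeyl.ofWord (X : ClassicalType) (n : ℕ) : FreeGroup (CoverGen X n) →* SpinWeyl X n :=
  (SpinWeyl.ofCover X n).comp (PresentedGroup.mk _)

variable {X : ClassicalType} {n : ℕ}

theorem SpinWeyl.ofWord_wt (i : Idx (rank X n)) : ofWord X n (wt i) = t i := rfl

theorem SpinWeyl.ofWord_wpi (r : PiIdx X n) : ofWord X n (wpi r) = tpi r := rfl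

theorem SpinWeyl.ofWord_wz : ofWord X n wz = -1 := by
  have h : SpinWeyl.mk X n _ = SpinWeyl.mk X n _ := RingQuot.mkAlgHom_rel ℂ SpinRel.z_add_one
  rw [map_add, map_one, map_zero] at h
  exact eq_neg_of_add_eq_zero_left h

theorem SpinWeyl.ofWord_eq {a b : FreeGroup (CoverGen X n)} (h : CoverRel X n a b) :
    ofWord X n a = ofWord X n b := by
  refine congrArg (ofCover X n) (eq_of_mul_inv_eq_one ?_)
  rw [← map_inv, ← map_mul]
  exact PresentedGroup.one_of_mem ⟨a, b, h, rfl⟩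

theorem coxeterM_self (X : ClassicalType) (n i : ℕ) : coxeterM X n i i = 1 := by
  cases X <;> simp [coxeterM]

theorem SpinWeyl.t_mul_self (i : Idx (rank X n)) : (t i : SpinWeyl X n) * t i = 1 := by
  have h := ofWord_eq (CoverRel.coxeter_odd i i (.inl (coxeterM_self X n i)))
  rwa [coxeterM_self, pow_one, map_mul, map_one] at h

/-- The inverse of `t_{π_r}`. -/
def SpinWeyl.tpiInv (r : PiIdx X n) : SpinWeyl X n := ofWord X n (wpi r)⁻¹

theorem SpinWeyl.tpi_mul_tpiInv (r : PiIdx X n) : tpi r * tpiInv r = 1 := by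
  rw [← ofWord_wpi, tpiInv, ← map_mul, mul_inv_cancel, map_one]

theorem SpinWeyl.tpiInv_mul_tpi (r : PiIdx X n) : tpiInv r * tpi r = 1 := by
  rw [← ofWord_wpi, tpiInv, ← map_mul, inv_mul_cancel, map_one]

end SpinWeyl

section Involutions

variable {R : Type*} [Ring R] {a b : R}

/-- For involutions, the relation `(a b)² = -1` is an anticommutation. -/
theorem mul_eq_neg_mul_iff (ha : a * a = 1) (hb : b * b = 1) :
    (a * b) ^ 2 = -1 ↔ a * b = -(b * a) := by
  constructor
  · intro h
    calc a * b = (a * b) ^ 2 * (b * a) := by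
          simp only [pow_succ, pow_zero, one_mul, mul_assoc]
          rw [← mul_assoc b b, hb, one_mul, ha, mul_one]
      _ = _ := by rw [h, neg_one_mul]
  · intro h
    calc (a * b) ^ 2 = -(b * a) * (a * b) := by rw [pow_two]; nth_rw 1 [h]
      _ = -(b * (a * a) * b) := by simp only [mul_assoc, neg_mul]
      _ = -1 := by rw [ha, mul_one, hb]

/-- For involutions, the relation `(a b)³ = 1` is a braid relation. -/
theorem mul_mul_eq_iff (ha : a * a = 1) (hb : b * b = 1) :
    (a * b) ^ 3 = 1 ↔ a * b * a = b * a * b := by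
  constructor
  · intro h
    calc a * b * a = (a * b) ^ 3 * (b * a * b) := by
          simp only [pow_succ, pow_zero, one_mul, mul_assoc]
          rw [← mul_assoc b b, hb, one_mul, ← mul_assoc a a b, ha, one_mul, hb, mul_one]
      _ = _ := by rw [h, one_mul]
  · intro h
    calc (a * b) ^ 3 = a * b * a * (b * a * b) := by
          simp only [pow_succ, pow_zero, one_mul, mul_assoc]
      _ = b * a * b * (b * a * b) := by rw [h]
      _ = b * (a * (b * b) * a) * b := by simp only [mul_assoc]
      _ = 1 := by rw [hb, mul_one, ha, mul_one, hb]

/-- For involutions, the relation `(a b)⁴ = -1` is a signed braid relation. -/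
theorem mul_mul_mul_eq_neg_iff (ha : a * a = 1) (hb : b * b = 1) :
    (a * b) ^ 4 = -1 ↔ a * b * a * b = -(b * a * b * a) := by
  constructor
  · intro h
    calc a * b * a * b = (a * b) ^ 4 * (b * a * b * a) := by
          simp only [pow_succ, pow_zero, one_mul, mul_assoc]
          rw [← mul_assoc b b, hb, one_mul, ← mul_assoc a a (b * a), ha, one_mul,
            ← mul_assoc b b a, hb, one_mul, ha, mul_one]
      _ = _ := by rw [h, neg_one_mul]
  · intro h
    calc (a * b) ^ 4 = a * b * a * b * (a * b * a * b) := by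
          simp only [pow_succ, pow_zero, one_mul, mul_assoc]
      _ = -(b * a * b * a) * (a * b * a * b) := by nth_rw 1 [h]
      _ = -(b * (a * (b * (a * a) * b) * a) * b) := by simp only [mul_assoc, neg_mul]
      _ = -1 := by rw [ha, mul_one, hb, mul_one, ha, mul_one, hb]

end Involutions

/-! ### The action of the covering group -/

section Action

variable {X : ClassicalType} {n : ℕ} (u v : ℂ) (hn : Admissible X n)

variable (X n) in
/-- The space on which the double affine Hecke algebra is made to act. -/
abbrev PBW : Type := Skew n ⊗[ℂ] SpinWeyl X n

/-- The operator by which `t_i` acts. -/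
def opT (i : Idx (rank X n)) : Module.End ℂ (PBW X n) := (nodeTwist u v hn i).op (SpinWeyl.t i)

/-- The operator by which `t_{π_r}` acts. -/
def opPi (r : PiIdx X n) : Module.End ℂ (PBW X n) := (piTwist r).op (SpinWeyl.tpi r)

theorem opT_rule (i : Idx (rank X n)) :
    (nodeTwist u v hn i).Rule (mulξ n _) (opT u v hn i) := Twist.cross_op _ _

theorem opPi_cross (r : PiIdx X n) :
    Cross (mulξ n _) (opPi r) (piData X n r).1 ((-1) ^ (piData X n r).2) 0 := Twist.cross_op _ _

theorem opT_mul_self (i : Idx (rank X n)) : opT u v hn i * opT u v hn i = 1 :=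
  Twist.op_ofSwap_mul_self _ _ _ (SpinWeyl.t_mul_self i)

/-- The action of a generator of the covering group. The central generator `z` acts by `-1`. -/
def genUnit : CoverGen X n → (Module.End ℂ (PBW X n))ˣ
  | .z => -1
  | .t i => ⟨opT u v hn i, opT u v hn i, opT_mul_self u v hn i, opT_mul_self u v hn i⟩
  | .pi r => ⟨opPi r, (piTwistInv r).op (SpinWeyl.tpiInv r),
      Twist.op_ofPerm_mul_op_ofPerm (mul_inv_cancel _) (pow_mul_pow_eq_one _ (by norm_num))
        (SpinWeyl.tpi_mul_tpiInv r),
      Twist.op_ofPerm_mul_op_ofPerm (inv_mul_cancel _) (pow_mul_pow_eq_one _ (by norm_num))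
        (SpinWeyl.tpiInv_mul_tpi r)⟩

/-- The action of a word. -/
def wordUnit : FreeGroup (CoverGen X n) →* (Module.End ℂ (PBW X n))ˣ :=
  FreeGroup.lift (genUnit u v hn)

theorem wordUnit_wz : (wordUnit u v hn wz : Module.End ℂ (PBW X n)) = -1 := by
  rw [wordUnit, wz, FreeGroup.lift_apply_of]
  rfl

theorem wordUnit_wz_mul (w : FreeGroup (CoverGen X n)) :
    (wordUnit u v hn (wz * w) : Module.End ℂ (PBW X n)) = -wordUnit u v hn w := by
  rw [map_mul, Units.val_mul, wordUnit_wz]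
  rfl

theorem wordUnit_mul_wz (w : FreeGroup (CoverGen X n)) :
    (wordUnit u v hn (w * wz) : Module.End ℂ (PBW X n)) = -wordUnit u v hn w := by
  rw [map_mul, Units.val_mul, wordUnit_wz]
  exact LinearMap.ext fun m => map_neg (wordUnit u v hn w : Module.End ℂ (PBW X n)) m

theorem wordUnit_wt (i : Idx (rank X n)) :
    (wordUnit u v hn (wt i) : Module.End ℂ (PBW X n)) = opT u v hn i := by
  rw [wordUnit, wt, FreeGroup.lift_apply_of]
  rfl

theorem wordUnit_wpi (r : PiIdx X n) :
    (wordUnit u v hn (wpi r) : Module.End ℂ (PBW X n)) = opPi r := by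
  rw [wordUnit, wpi, FreeGroup.lift_apply_of]
  rfl

/-- On the vectors `1 ⊗ b`, words act through left multiplication on `ℂW^{e-}`. -/
theorem wordUnit_one_tmul (w : FreeGroup (CoverGen X n)) (b : SpinWeyl X n) :
    (wordUnit u v hn w : Module.End ℂ (PBW X n)) (1 ⊗ₜ b) = 1 ⊗ₜ (SpinWeyl.ofWord X n w * b) := by
  have key (g : CoverGen X n) (b : SpinWeyl X n) :
      (wordUnit u v hn (.of g) : Module.End ℂ (PBW X n)) (1 ⊗ₜ b) =
        1 ⊗ₜ (SpinWeyl.ofWord X n (.of g) * b) := by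
    cases g with
    | z =>
      change (wordUnit u v hn wz : Module.End ℂ (PBW X n)) _ = 1 ⊗ₜ (SpinWeyl.ofWord X n wz * b)
      rw [wordUnit_wz, SpinWeyl.ofWord_wz, neg_one_mul, TensorProduct.tmul_neg]
      rfl
    | t i =>
      change (wordUnit u v hn (wt i) : Module.End ℂ (PBW X n)) _ = _
      rw [wordUnit_wt]
      exact Twist.op_one_tmul _ _ _
    | pi r =>
      change (wordUnit u v hn (wpi r) : Module.End ℂ (PBW X n)) _ = _
      rw [wordUnit_wpi]
      exact Twist.op_one_tmul _ _ _
  induction w using FreeGroup.induction_on generalizing b with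
  | C1 => simp
  | of g => exact key g b
  | inv_of g h =>
    have h' := key g (SpinWeyl.ofWord X n (.of g)⁻¹ * b)
    rw [← mul_assoc, ← map_mul, mul_inv_cancel, map_one, one_mul] at h'
    rw [← h', ← Module.End.mul_apply, ← Units.val_mul, ← map_mul, inv_mul_cancel, map_one]
    rfl
  | mul w w' h h' =>
    rw [map_mul, Units.val_mul, Module.End.mul_apply, h', h, map_mul, mul_assoc]

theorem wordUnit_eq_of_sameCross {a b : FreeGroup (CoverGen X n)}
    (h : SpinWeyl.ofWord X n a = SpinWeyl.ofWord X n b)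
    (hx : SameCross (mulξ n _) (wordUnit u v hn a : Module.End ℂ (PBW X n)) (wordUnit u v hn b)) :
    (wordUnit u v hn a : Module.End ℂ (PBW X n)) = wordUnit u v hn b :=
  hx.eq fun c => by rw [wordUnit_one_tmul, wordUnit_one_tmul, h]

theorem wordUnit_coxeter_odd (i j : Idx (rank X n))
    (h : coxeterM X n i j = 1 ∨ coxeterM X n i j = 3) :
    (wordUnit u v hn ((wt i * wt j) ^ coxeterM X n i j) : Module.End ℂ (PBW X n)) = 1 := by
  rw [map_pow, map_mul, Units.val_pow_eq_pow_val, Units.val_mul, wordUnit_wt, wordUnit_wt]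
  rcases h with h | h
  · obtain rfl := coxeterM_eq_one h
    rw [h, pow_one, opT_mul_self]
  · have hV := SpinWeyl.ofWord_eq (CoverRel.coxeter_odd i j (.inr h))
    rw [h, map_pow, map_mul, map_one, SpinWeyl.ofWord_wt, SpinWeyl.ofWord_wt,
      mul_mul_eq_iff (SpinWeyl.t_mul_self i) (SpinWeyl.t_mul_self j)] at hV
    rw [h, mul_mul_eq_iff (opT_mul_self u v hn i) (opT_mul_self u v hn j)]
    obtain ⟨hp, hi, hj, hij⟩ := coxeterM_three hn h u v
    have hTi := opT_rule u v hn i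
    have hTj := opT_rule u v hn j
    rw [nodeTwist] at hTi hTj
    rw [← hp] at hTj
    have := wordUnit_eq_of_sameCross u v hn (a := wt i * wt j * wt i) (b := wt j * wt i * wt j)
    simp only [map_mul, Units.val_mul, wordUnit_wt, SpinWeyl.ofWord_wt] at this
    exact this hV (Twist.Rule.sameCross_three hTi hTj (opT_mul_self u v hn i)
      (opT_mul_self u v hn j) hi hj hij)

theorem wordUnit_coxeter_even (i j : Idx (rank X n))
    (h : coxeterM X n i j = 2 ∨ coxeterM X n i j = 4) :
    (wordUnit u v hn ((wt i * wt j) ^ coxeterM X n i j) : Module.End ℂ (PBW X n)) = -1 := by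
  have hV := SpinWeyl.ofWord_eq (CoverRel.coxeter_even i j h)
  rw [map_pow, map_mul, SpinWeyl.ofWord_wz, SpinWeyl.ofWord_wt, SpinWeyl.ofWord_wt] at hV
  have hTi := opT_rule u v hn i
  have hTj := opT_rule u v hn j
  rw [map_pow, map_mul, Units.val_pow_eq_pow_val, Units.val_mul, wordUnit_wt, wordUnit_wt]
  rcases h with h | h
  · rw [h, mul_eq_neg_mul_iff (SpinWeyl.t_mul_self i) (SpinWeyl.t_mul_self j)] at hV
    rw [h, mul_eq_neg_mul_iff (opT_mul_self u v hn i) (opT_mul_self u v hn j)]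
    have := wordUnit_eq_of_sameCross u v hn (a := wt i * wt j) (b := wz * (wt j * wt i))
    rw [wordUnit_wz_mul] at this
    simp only [map_mul, Units.val_mul, wordUnit_wt, SpinWeyl.ofWord_wt, SpinWeyl.ofWord_wz,
      neg_one_mul] at this
    exact this hV (Twist.Rule.sameCross_two hTi hTj (coxeterM_two hn h))
  · rw [h, mul_mul_mul_eq_neg_iff (SpinWeyl.t_mul_self i) (SpinWeyl.t_mul_self j)] at hV
    rw [h, mul_mul_mul_eq_neg_iff (opT_mul_self u v hn i) (opT_mul_self u v hn j)]
    have := wordUnit_eq_of_sameCross u v hn (a := wt i * wt j * wt i * wt j)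
      (b := wz * (wt j * wt i * wt j * wt i))
    rw [wordUnit_wz_mul] at this
    simp only [map_mul, Units.val_mul, wordUnit_wt, SpinWeyl.ofWord_wt, SpinWeyl.ofWord_wz,
      neg_one_mul] at this
    exact this hV (Twist.Rule.sameCross_four hTi hTj (opT_mul_self u v hn i)
      (opT_mul_self u v hn j) (coxeterM_four hn h))

end Action

section Relations

theorem opPi_cross_A {n : ℕ} (r : PiIdx .A n) :
    Cross (mulξ n _) (opPi r) (rotate n) ((-1) ^ (n - 1)) 0 := opPi_cross r

theorem opPi_cross_B {n : ℕ} (r : PiIdx .B n) : Cross (mulξ n _) (opPi r) id (-1) 0 := by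
  have h := opPi_cross r
  rwa [piData, pow_one] at h

theorem opPi_cross_D_last {n : ℕ} (r : PiIdx .D n) (hr : (r : ℕ) = n) :
    Cross (mulξ n _) (opPi r) (reverse n) ((-1) ^ (n / 2)) 0 := by
  have h := opPi_cross r
  rwa [piData, if_pos hr] at h

theorem opPi_cross_D_one {n : ℕ} (hn : Admissible .D n) (r : PiIdx .D n) (hr : (r : ℕ) = 1) :
    Cross (mulξ n _) (opPi r) id 1 0 := by
  have h := opPi_cross r
  have hr' : (r : ℕ) ≠ n := by
    simp only [Admissible] at hn
    omega
  rwa [piData, if_neg hr', pow_zero] at h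

theorem piIdx_eq_of_odd {n : ℕ} (hn : Odd n) (r : PiIdx .D n) : (r : ℕ) = n :=
  r.2.resolve_left fun h => Nat.not_even_iff_odd.2 hn h.1

theorem neg_one_pow_mul_self (m : ℕ) : (-1 : ℂ) ^ m * (-1) ^ m = 1 :=
  pow_mul_pow_eq_one _ (by norm_num)

variable {X : ClassicalType} {n : ℕ} (u v : ℂ) (hn : Admissible X n)

/-- The relations of the form `w t̃_i = z^m t̃_j w`, with `w` a word in the `π̃_r`. -/
theorem wordUnit_slide {w : FreeGroup (CoverGen X n)} {p : Idx n → Idx n} {ε : ℂ} {m : ℕ}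
    {i j : Idx (rank X n)}
    (hw : Cross (mulξ n _) (wordUnit u v hn w : Module.End ℂ (PBW X n)) p ε 0)
    (hp : p.Injective) (hε : (-1) ^ m * ε = 1) (hu : nodeParam u v X n i = nodeParam u v X n j)
    (hij : ((p (nodeLo hn i) : ℕ) = nodeLo hn j ∧ (p (nodeHi hn i) : ℕ) = nodeHi hn j) ∨
      ((p (nodeLo hn i) : ℕ) = nodeHi hn j ∧ (p (nodeHi hn i) : ℕ) = nodeLo hn j))
    (hV : CoverRel X n (w * wt i) (wz ^ m * wt j * w)) :
    (wordUnit u v hn (w * wt i) : Module.End ℂ (PBW X n)) = wordUnit u v hn (wz ^ m * wt j * w) := by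
  refine wordUnit_eq_of_sameCross u v hn (SpinWeyl.ofWord_eq hV) ?_
  have hTi := opT_rule u v hn i
  have hTj := opT_rule u v hn j
  rw [nodeTwist] at hTi hTj
  rw [← hu] at hTj
  have h := Twist.Rule.slide hw hp hTi hTj (by simpa only [Subtype.ext_iff] using hij) hε
  have hz : (-1 : Module.End ℂ (PBW X n)) ^ m = ((-1 : ℂ) ^ m) • 1 := by
    rw [Algebra.smul_def, mul_one, map_pow, map_neg, map_one]
  simpa only [map_mul, map_pow, Units.val_mul, Units.val_pow_eq_pow_val, wordUnit_wt, wordUnit_wz,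
    mul_assoc, hz, smul_one_mul] using h

/-- The relations of the form `w t̃_i = t̃_j w`, with `w` a word in the `π̃_r`. -/
theorem wordUnit_slide_zero {w : FreeGroup (CoverGen X n)} {p : Idx n → Idx n} {ε : ℂ}
    {i j : Idx (rank X n)}
    (hw : Cross (mulξ n _) (wordUnit u v hn w : Module.End ℂ (PBW X n)) p ε 0)
    (hp : p.Injective) (hε : ε = 1) (hu : nodeParam u v X n i = nodeParam u v X n j)
    (hij : ((p (nodeLo hn i) : ℕ) = nodeLo hn j ∧ (p (nodeHi hn i) : ℕ) = nodeHi hn j) ∨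
      ((p (nodeLo hn i) : ℕ) = nodeHi hn j ∧ (p (nodeHi hn i) : ℕ) = nodeLo hn j))
    (hV : CoverRel X n (w * wt i) (wt j * w)) :
    (wordUnit u v hn (w * wt i) : Module.End ℂ (PBW X n)) = wordUnit u v hn (wt j * w) := by
  have h := wordUnit_slide u v hn (m := 0) hw hp (by rw [pow_zero, one_mul, hε]) hu hij
  rw [pow_zero, one_mul] at h
  exact h hV

/-- A relation whose two sides are words in the `π̃_r` and `z` only. -/
theorem wordUnit_eq_of_cross {a b : FreeGroup (CoverGen X n)} {p p' : Idx n → Idx n} {ε ε' : ℂ}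
    (hV : CoverRel X n a b)
    (ha : Cross (mulξ n _) (wordUnit u v hn a : Module.End ℂ (PBW X n)) p ε 0)
    (hb : Cross (mulξ n _) (wordUnit u v hn b : Module.End ℂ (PBW X n)) p' ε' 0)
    (hp : ∀ k, p k = p' k) (hε : ε = ε') :
    (wordUnit u v hn a : Module.End ℂ (PBW X n)) = wordUnit u v hn b :=
  wordUnit_eq_of_sameCross u v hn (SpinWeyl.ofWord_eq hV) (ha.sameCross hb hp hε)

theorem cross_wordUnit_pow {w : FreeGroup (CoverGen X n)} {p : Idx n → Idx n} {ε : ℂ} (m : ℕ)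
    (hw : Cross (mulξ n _) (wordUnit u v hn w : Module.End ℂ (PBW X n)) p ε 0) :
    Cross (mulξ n _) (wordUnit u v hn (w ^ m) : Module.End ℂ (PBW X n)) p^[m] (ε ^ m) 0 := by
  rw [map_pow, Units.val_pow_eq_pow_val]
  exact hw.pow m

theorem cross_wordUnit_mul {w w' : FreeGroup (CoverGen X n)} {p p' : Idx n → Idx n} {ε ε' : ℂ}
    (hw : Cross (mulξ n _) (wordUnit u v hn w : Module.End ℂ (PBW X n)) p ε 0)
    (hw' : Cross (mulξ n _) (wordUnit u v hn w' : Module.End ℂ (PBW X n)) p' ε' 0) :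
    Cross (mulξ n _) (wordUnit u v hn (w * w') : Module.End ℂ (PBW X n)) (p ∘ p') (ε * ε') 0 := by
  rw [map_mul, Units.val_mul]
  exact hw.mul hw'

theorem cross_wordUnit_one :
    Cross (mulξ n _) (wordUnit u v hn 1 : Module.End ℂ (PBW X n)) id 1 0 := by
  rw [map_one]
  exact Cross.one _

theorem cross_wordUnit_wz :
    Cross (mulξ n _) (wordUnit u v hn wz : Module.End ℂ (PBW X n)) id 1 0 := by
  intro k
  rw [wordUnit_wz, Pi.zero_apply, zero_smul, add_zero, one_smul]
  exact LinearMap.ext fun m => (map_neg (mulξ n (SpinWeyl X n) k) m).symm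

theorem reverse_iterate_two : (reverse n)^[2] = id := funext reverse_reverse

set_option maxHeartbeats 1000000 in
/-- The operators satisfy the defining relations of the covering group. For every relation, both
sides agree on `1 ⊗ b`, because the relation holds in `ℂW^{e-}`; so it suffices that both sides are
moved past the `ξ_k` by the same formula. -/
theorem wordUnit_eq_of_coverRel {a b : FreeGroup (CoverGen X n)} (h : CoverRel X n a b) :
    (wordUnit u v hn a : Module.End ℂ (PBW X n)) = wordUnit u v hn b := by
  have h₀ := h
  have hz := cross_wordUnit_wz u v hn
  cases h with
  | z_sq =>
    rw [pow_two, wordUnit_wz_mul, wordUnit_wz, map_one, Units.val_one]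
    exact neg_neg _
  | z_t i => rw [wordUnit_wz_mul, wordUnit_mul_wz]
  | z_pi r => rw [wordUnit_wz_mul, wordUnit_mul_wz]
  | coxeter_odd i j h =>
    rw [wordUnit_coxeter_odd u v hn i j h, map_one, Units.val_one]
  | coxeter_even i j h => rw [wordUnit_coxeter_even u v hn i j h, wordUnit_wz]
  | A_sq hX r i j hi hj =>
    subst hX
    have hr := opPi_cross_A r
    rw [← wordUnit_wpi u v hn] at hr
    refine wordUnit_slide_zero u v hn (cross_wordUnit_pow u v hn 2 hr)
      ((rotate n).injective.iterate 2) ?_ rfl (.inl ⟨?_, ?_⟩) h₀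
    · rw [pow_two, neg_one_pow_mul_self]
    all_goals
      simp only [Function.iterate_succ_apply, Function.iterate_zero_apply, rotate_coe, nodeLo,
        nodeHi, loVal, hiVal]
      grind [rank]
  | A_pow hX r i =>
    subst hX
    have hr := opPi_cross_A r
    rw [← wordUnit_wpi u v hn] at hr
    refine wordUnit_slide_zero u v hn (cross_wordUnit_pow u v hn n hr)
      ((rotate n).injective.iterate n) ?_ rfl (.inl ⟨?_, ?_⟩) h₀
    · rw [← pow_mul, mul_comm]
      exact (Nat.even_mul_pred_self n).neg_one_pow
    all_goals rw [rotate_iterate_self]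
  | A_shift hX r i j hj =>
    subst hX
    have hr := opPi_cross_A r
    rw [← wordUnit_wpi u v hn] at hr
    refine wordUnit_slide u v hn hr (rotate n).injective (neg_one_pow_mul_self _) rfl
      (.inl ⟨?_, ?_⟩) h₀
    all_goals
      simp only [rotate_coe, nodeLo, nodeHi, loVal, hiVal]
      grind [rank]
  | B_sq hX r =>
    subst hX
    have hr := opPi_cross_B r
    rw [← wordUnit_wpi u v hn] at hr
    exact wordUnit_eq_of_cross u v hn h₀ (cross_wordUnit_pow u v hn 2 hr)
      (cross_wordUnit_one u v hn) (fun k => rfl) (by norm_num)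
  | B_comm hX r i hi =>
    subst hX
    have hr := opPi_cross_B r
    rw [← wordUnit_wpi u v hn] at hr
    have h := wordUnit_slide u v hn (m := 1) (i := i) (j := i) hr Function.injective_id
      (by norm_num) rfl (.inl ⟨rfl, rfl⟩)
    rw [pow_one] at h
    exact h h₀
  | B_braid hX r i hi =>
    subst hX
    have hr := opPi_cross_B r
    have hPP : opPi r * opPi r = 1 := by
      have h := wordUnit_eq_of_cross u v hn (.B_sq rfl r)
        (cross_wordUnit_pow u v hn 2 (by rwa [wordUnit_wpi]))
        (cross_wordUnit_one u v hn) (fun k => rfl) (by norm_num)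
      simpa [wordUnit_wpi, pow_two] using h
    refine wordUnit_eq_of_sameCross u v hn (SpinWeyl.ofWord_eq h₀) ?_
    simp only [mul_assoc wz, wordUnit_wz_mul]
    simp only [map_mul, Units.val_mul, wordUnit_wt, wordUnit_wpi]
    exact hr.sameCross_braid (opT_rule u v hn i) hPP (Equiv.swap_apply_self _ _)
      fun k => Twist.shift_swap _ _ k _
  | Dodd_pow hX hodd r =>
    subst hX
    have hr := opPi_cross_D_last r (piIdx_eq_of_odd hodd r)
    rw [← wordUnit_wpi u v hn] at hr
    refine wordUnit_eq_of_cross u v hn h₀ (cross_wordUnit_pow u v hn 4 hr) hz (fun k => ?_) ?_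
    · rw [Function.iterate_add _ 2 2, reverse_iterate_two]
      rfl
    · rw [← pow_mul, mul_comm]
      exact (Even.mul_right (by decide) _).neg_one_pow
  | Dodd_sq hX hodd r i j hi hj =>
    subst hX
    have hr := opPi_cross_D_last r (piIdx_eq_of_odd hodd r)
    rw [← wordUnit_wpi u v hn] at hr
    refine wordUnit_slide_zero u v hn (cross_wordUnit_pow u v hn 2 hr)
      ((reverse n).injective.iterate 2) ?_ rfl (.inl ⟨?_, ?_⟩) h₀
    · rw [pow_two, neg_one_pow_mul_self]
    all_goals
      simp only [reverse_iterate_two, id, nodeLo, nodeHi, loVal, hiVal]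
      grind [rank, Admissible]
  | Dodd_flip hX hodd r i j hi hj =>
    subst hX
    have hr := opPi_cross_D_last r (piIdx_eq_of_odd hodd r)
    rw [← wordUnit_wpi u v hn, show n / 2 = (n - 1) / 2 by grind] at hr
    refine wordUnit_slide u v hn hr (reverse n).injective (neg_one_pow_mul_self _) rfl
      (.inr ⟨?_, ?_⟩) h₀
    all_goals
      simp only [reverse_coe, nodeLo, nodeHi, loVal, hiVal]
      grind [rank, Admissible]
  | Dodd_last hX hodd r i j hi hj =>
    subst hX
    have hr := opPi_cross_D_last r (piIdx_eq_of_odd hodd r)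
    rw [← wordUnit_wpi u v hn, show n / 2 = (n - 1) / 2 by grind] at hr
    refine wordUnit_slide u v hn hr (reverse n).injective (neg_one_pow_mul_self _) rfl
      (.inr ⟨?_, ?_⟩) h₀
    all_goals
      simp only [reverse_coe, nodeLo, nodeHi, loVal, hiVal]
      grind [rank, Admissible]
  | Deven_sq_one hX heven p hp =>
    subst hX
    have hr := opPi_cross_D_one hn p hp
    rw [← wordUnit_wpi u v hn] at hr
    exact wordUnit_eq_of_cross u v hn h₀ (cross_wordUnit_pow u v hn 2 hr)
      (cross_wordUnit_one u v hn) (fun k => rfl) (by norm_num)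
  | Deven_sq_n hX heven q hq =>
    subst hX
    have hr := opPi_cross_D_last q hq
    rw [← wordUnit_wpi u v hn] at hr
    refine wordUnit_eq_of_cross u v hn h₀ (cross_wordUnit_pow u v hn 2 hr)
      (cross_wordUnit_pow u v hn _ hz) (fun k => ?_) ?_
    · rw [reverse_iterate_two, Function.iterate_id]
    · rw [pow_two, neg_one_pow_mul_self, one_pow]
  | Deven_pi_pi hX heven p q hp hq =>
    subst hX
    have hr := opPi_cross_D_one hn p hp
    have hr' := opPi_cross_D_last q hq
    rw [← wordUnit_wpi u v hn] at hr hr'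
    exact wordUnit_eq_of_cross u v hn h₀ (cross_wordUnit_mul u v hn hr hr')
      (cross_wordUnit_mul u v hn (cross_wordUnit_mul u v hn hz hr') hr) (fun k => rfl) (by ring)
  | Deven_conj hX heven p q hp hq i j hi hj =>
    subst hX
    have hr := opPi_cross_D_one hn p hp
    have hr' := opPi_cross_D_last q hq
    have hPP : opPi p * opPi p = 1 := by
      have h := wordUnit_eq_of_cross u v hn (.Deven_sq_one rfl heven p hp)
        (cross_wordUnit_pow u v hn 2 (by rwa [wordUnit_wpi]))
        (cross_wordUnit_one u v hn) (fun k => rfl) (by norm_num)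
      simpa [wordUnit_wpi, pow_two] using h
    -- The sign `(-1) ^ (n / 2 + 1)` is `-δ` for the sign `δ` in the rule of `t_{π_n}`.
    have hQQ : opPi q * opPi q = (-(-1 : ℂ) ^ (n / 2)) • 1 := by
      have h := wordUnit_eq_of_cross u v hn (.Deven_sq_n rfl heven q hq)
        (cross_wordUnit_pow u v hn 2 (by rwa [wordUnit_wpi]))
        (cross_wordUnit_pow u v hn _ hz) (fun k => by
          rw [reverse_iterate_two, Function.iterate_id])
          (by rw [pow_two, neg_one_pow_mul_self, one_pow])
      rw [map_pow, map_pow, Units.val_pow_eq_pow_val, Units.val_pow_eq_pow_val, wordUnit_wpi,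
        wordUnit_wz, pow_two] at h
      rw [h, Algebra.smul_def, mul_one, map_neg, map_pow, map_neg, map_one, pow_succ]
      exact LinearMap.ext fun m => map_neg ((-1 : Module.End ℂ (PBW .D n)) ^ (n / 2)) m
    refine wordUnit_eq_of_sameCross u v hn (SpinWeyl.ofWord_eq h₀) ?_
    have hlo : reverse n (nodeLo hn j) = nodeHi hn i := by
      refine Subtype.ext ?_
      simp only [reverse_coe, nodeLo, nodeHi, loVal, hiVal]
      grind [Admissible]
    have hhi : reverse n (nodeHi hn j) = nodeLo hn i := by
      refine Subtype.ext ?_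
      simp only [reverse_coe, nodeLo, nodeHi, loVal, hiVal]
      grind [Admissible]
    simp only [mul_assoc wz, wordUnit_wz_mul]
    simp only [map_mul, Units.val_mul, wordUnit_wt, wordUnit_wpi]
    exact hr.sameCross_conj hr' (opT_rule u v hn i) (opT_rule u v hn j) hPP hQQ
      (neg_one_pow_mul_self _)
      (fun k => by
        simp only [nodeTwist, Twist.ofSwap, Equiv.swap_apply_def, ← hlo, ← hhi]
        grind [reverse_reverse])
      (fun k => by
        simp only [nodeTwist, Twist.ofSwap, ← hlo, ← hhi, nodeParam]
        grind [reverse_reverse])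
  | Deven_one_comm hX heven p hp i hi hi' =>
    subst hX
    have hr := opPi_cross_D_one hn p hp
    rw [← wordUnit_wpi u v hn] at hr
    exact wordUnit_slide_zero u v hn hr Function.injective_id rfl rfl (.inl ⟨rfl, rfl⟩) h₀
  | Deven_n_flip hX heven q hq i j hi hi' hj =>
    subst hX
    have hr := opPi_cross_D_last q hq
    rw [← wordUnit_wpi u v hn] at hr
    refine wordUnit_slide u v hn hr (reverse n).injective (neg_one_pow_mul_self _) rfl
      (.inr ⟨?_, ?_⟩) h₀
    all_goals
      simp only [reverse_coe, nodeLo, nodeHi, loVal, hiVal]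
      grind [rank, Admissible]
  | Deven_one_last hX heven p hp i j hi hj =>
    subst hX
    have hr := opPi_cross_D_one hn p hp
    rw [← wordUnit_wpi u v hn] at hr
    refine wordUnit_slide_zero u v hn hr Function.injective_id rfl rfl (.inl ⟨?_, ?_⟩) h₀
    · simp only [id, nodeLo, loVal]
      grind [Admissible]
    · simp only [id, nodeHi, hiVal]
      grind [Admissible]
  | Deven_n_first hX heven q hq i j hi hj =>
    subst hX
    have hr := opPi_cross_D_last q hq
    rw [← wordUnit_wpi u v hn] at hr
    refine wordUnit_slide u v hn hr (reverse n).injective (neg_one_pow_mul_self _) rfl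
      (.inr ⟨?_, ?_⟩) h₀
    all_goals
      simp only [reverse_coe, nodeLo, nodeHi, loVal, hiVal]
      grind [rank, Admissible]

end Relations

/-! ### The action of the double affine Hecke algebra -/

section HeckeAction

/-- `ℂW^{e-}` is spanned by the images of the words in the generators. -/
theorem SpinWeyl.induction {X : ClassicalType} {n : ℕ} {p : SpinWeyl X n → Prop}
    (word : ∀ w, p (ofWord X n w)) (add : ∀ a b, p a → p b → p (a + b))
    (smul : ∀ (c : ℂ) a, p a → p (c • a)) (a : SpinWeyl X n) : p a := by
  obtain ⟨f, rfl⟩ : ∃ f, SpinWeyl.mk X n f = a := RingQuot.mkAlgHom_surjective ℂ (SpinRel X n) a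
  induction f using MonoidAlgebra.induction_on with
  | of g =>
    obtain ⟨w, rfl⟩ := PresentedGroup.mk_surjective _ g
    exact word w
  | add f g hf hg =>
    rw [map_add]
    exact add _ _ hf hg
  | smul c f hf =>
    rw [map_smul]
    exact smul _ _ hf

section Rules

variable {n : ℕ} {E : Type*} [Ring E] [Algebra ℂ E] {x : Idx n → E} {T : E} {a b : Idx n} {w : ℂ}

theorem Twist.Rule.mul_left (h : (ofSwap a b w).Rule x T) :
    T * x a = -(x b * T) + algebraMap ℂ E w := by
  rw [h a, Algebra.algebraMap_eq_smul_one]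
  simp [ofSwap]

theorem Twist.Rule.mul_right (h : (ofSwap a b w).Rule x T) :
    T * x b = -(x a * T) + algebraMap ℂ E w := by
  rw [h b, Algebra.algebraMap_eq_smul_one]
  simp [ofSwap]

theorem Twist.Rule.mul_of_ne (h : (ofSwap a b w).Rule x T) {k : Idx n} (ha : k ≠ a) (hb : k ≠ b) :
    T * x k = -(x k * T) := by
  rw [h k]
  simp [ofSwap, Equiv.swap_apply_of_ne_of_ne ha hb, ha, hb]

/-- For an involution `T`, the rule for `T x_a` implies the one for `T x_b`. -/
theorem Twist.Rule.of_left (hT : T * T = 1) (h : T * x a = -(x b * T) + algebraMap ℂ E w)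
    (h' : ∀ k, k ≠ a → k ≠ b → T * x k = -(x k * T)) : (ofSwap a b w).Rule x T := by
  intro k
  rw [Algebra.algebraMap_eq_smul_one] at h
  by_cases ha : k = a
  · subst ha
    simp [ofSwap, h]
  by_cases hb : k = b
  · subst hb
    -- Multiply the rule for `T x_a` by `T` on both sides.
    have h₂ : T * (T * x a) * T = T * (-(x k * T) + w • 1) * T := by rw [h]
    rw [← mul_assoc, hT, one_mul, mul_add, add_mul, mul_neg, neg_mul, mul_smul_comm,
      smul_mul_assoc, mul_one, hT, ← mul_assoc, mul_assoc _ T T, hT, mul_one] at h₂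
    simp [ofSwap, h₂]
  · rw [h' k ha hb]
    simp [ofSwap, Equiv.swap_apply_of_ne_of_ne ha hb, ha, hb]

theorem Twist.Rule.of_right (hT : T * T = 1) (h : T * x b = -(x a * T) + algebraMap ℂ E w)
    (h' : ∀ k, k ≠ a → k ≠ b → T * x k = -(x k * T)) : (ofSwap a b w).Rule x T := by
  have h₁ : (ofSwap b a w).Rule x T := of_left hT h fun k hb ha => h' k ha hb
  intro k
  rw [h₁ k]
  simp only [ofSwap, Equiv.swap_comm a b, or_comm]

end Rules

variable {X : ClassicalType} {n : ℕ} (u v : ℂ) (hn : Admissible X n)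

/-- The action of the covering group on `𝒞[ξ] ⊗ ℂW^{e-}`. -/
def coverUnit : Cover X n →* (Module.End ℂ (PBW X n))ˣ :=
  PresentedGroup.toGroup (f := genUnit u v hn) (by
    rintro _ ⟨a, b, h, rfl⟩
    rw [map_mul, map_inv, mul_inv_eq_one]
    exact Units.ext (wordUnit_eq_of_coverRel u v hn h))

/-- The action of `ℂW^{e-}` on `𝒞[ξ] ⊗ ℂW^{e-}`. -/
def weylAction : SpinWeyl X n →ₐ[ℂ] Module.End ℂ (PBW X n) :=
  RingQuot.liftAlgHom ℂ ⟨MonoidAlgebra.lift ℂ _ _ ((Units.coeHom _).comp (coverUnit u v hn)), by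
    rintro _ _ ⟨⟩
    rw [map_add, MonoidAlgebra.lift_of, map_one, map_zero]
    change (wordUnit u v hn wz : Module.End ℂ (PBW X n)) + 1 = 0
    rw [wordUnit_wz]
    exact neg_add_cancel _⟩

theorem weylAction_ofWord (w : FreeGroup (CoverGen X n)) :
    weylAction u v hn (SpinWeyl.ofWord X n w) = wordUnit u v hn w := by
  refine (RingQuot.liftAlgHom_mkAlgHom_apply ℂ _ _ _).trans ?_
  rw [MonoidAlgebra.lift_of]
  rfl

theorem weylAction_t (i : Idx (rank X n)) : weylAction u v hn (SpinWeyl.t i) = opT u v hn i := by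
  rw [← SpinWeyl.ofWord_wt, weylAction_ofWord, wordUnit_wt]

theorem weylAction_tpi (r : PiIdx X n) : weylAction u v hn (SpinWeyl.tpi r) = opPi r := by
  rw [← SpinWeyl.ofWord_wpi, weylAction_ofWord, wordUnit_wpi]

theorem weylAction_one_tmul (b c : SpinWeyl X n) :
    weylAction u v hn b (1 ⊗ₜ c) = 1 ⊗ₜ (b * c) := by
  induction b using SpinWeyl.induction with
  | word w => rw [weylAction_ofWord, wordUnit_one_tmul]
  | add a b ha hb => rw [map_add, LinearMap.add_apply, ha, hb, add_mul, TensorProduct.tmul_add]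
  | smul r a ha => rw [map_smul, LinearMap.smul_apply, ha, smul_mul_assoc, TensorProduct.tmul_smul]

theorem opT_lo (i : Idx (rank X n)) {j k : Idx n} (hj : (j : ℕ) = loVal X n i)
    (hk : (k : ℕ) = hiVal X n i) : opT u v hn i * mulξ n _ j =
      -(mulξ n _ k * opT u v hn i) + algebraMap ℂ _ (nodeParam u v X n i) := by
  have h := (opT_rule u v hn i).mul_left
  rwa [show nodeLo hn i = j from Subtype.ext hj.symm,
    show nodeHi hn i = k from Subtype.ext hk.symm] at h

theorem opT_hi (i : Idx (rank X n)) {j k : Idx n} (hj : (j : ℕ) = hiVal X n i)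
    (hk : (k : ℕ) = loVal X n i) : opT u v hn i * mulξ n _ j =
      -(mulξ n _ k * opT u v hn i) + algebraMap ℂ _ (nodeParam u v X n i) := by
  have h := (opT_rule u v hn i).mul_right
  rwa [show nodeLo hn i = k from Subtype.ext hk.symm,
    show nodeHi hn i = j from Subtype.ext hj.symm] at h

theorem opT_of_ne (i : Idx (rank X n)) {j : Idx n} (hj : (j : ℕ) ≠ loVal X n i)
    (hj' : (j : ℕ) ≠ hiVal X n i) :
    opT u v hn i * mulξ n _ j = -(mulξ n _ j * opT u v hn i) :=
  (opT_rule u v hn i).mul_of_ne (fun h => hj (congrArg Subtype.val h))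
    fun h => hj' (congrArg Subtype.val h)

theorem Cross.zero_apply_pow {E : Type*} [Ring E] [Algebra ℂ E] {x : Idx n → E} {P : E}
    {p : Idx n → Idx n} {m : ℕ} (h : Cross x P p ((-1) ^ m) 0) {i j : Idx n} (hj : p i = j) :
    P * x i = (-1) ^ m * x j * P := by
  rw [h.zero_apply, hj, Algebra.smul_def, map_pow, map_neg, map_one, mul_assoc]

/-- The data of a node `i ≤ n - 1`; they are the same in all types. -/
theorem node_of_le (hn : Admissible X n) {i : ℕ} (hi : i ≤ n - 1) :
    loVal X n i = i ∧ hiVal X n i = i + 1 ∧ nodeParam u v X n i = u := by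
  cases X <;> simp only [loVal, hiVal, nodeParam] <;> grind [Admissible]

theorem nodeB : loVal .B n n = n ∧ hiVal .B n n = n ∧ nodeParam u v .B n n = v := by
  simp [loVal, hiVal, nodeParam]

theorem nodeD : loVal .D n n = n - 1 ∧ hiVal .D n n = n ∧ nodeParam u v .D n n = u := by
  simp [loVal, hiVal, nodeParam]

/-- The action of the generators of the free product on `𝒞[ξ] ⊗ ℂW^{e-}`. -/
def preAction : PreDAHA X n →ₐ[ℂ] Module.End ℂ (PBW X n) :=
  FreeAlgebra.lift ℂ (Sum.elim (leftMul n (SpinWeyl X n)) (weylAction u v hn))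

theorem preAction_pl (a : Skew n) : preAction u v hn (pl a) = leftMul n (SpinWeyl X n) a := by
  simp [preAction, pl]

theorem preAction_pr (b : SpinWeyl X n) : preAction u v hn (pr b) = weylAction u v hn b := by
  simp [preAction, pr]

theorem preAction_pξ (i : Idx n) : preAction u v hn (pξ i) = mulξ n (SpinWeyl X n) i :=
  preAction_pl u v hn _

theorem preAction_pt (i : Idx (rank X n)) : preAction u v hn (pt i) = opT u v hn i := by
  rw [pt, preAction_pr, weylAction_t]

theorem preAction_ptpi (r : PiIdx X n) : preAction u v hn (ptpi r) = opPi r := by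
  rw [ptpi, preAction_pr, weylAction_tpi]

/-- The defining relations of `Ḧ^-_W` hold for the operators on `𝒞[ξ] ⊗ ℂW^{e-}`. -/
theorem preAction_eq {a b : PreDAHA X n} (h : DAHARel X n u v a b) :
    preAction u v hn a = preAction u v hn b := by
  cases h with
  | l_add a b | l_mul a b | l_one | l_smul c a =>
    simp only [map_add, map_mul, map_one, map_smul, preAction_pl]
  | r_add a b | r_mul a b | r_one | r_smul c a =>
    simp only [map_add, map_mul, map_one, map_smul, preAction_pr]
  | t_ξ_self i j k hi hj hk =>
    obtain ⟨hlo, hhi, hp⟩ := node_of_le u v hn hi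
    simp only [map_add, map_mul, map_neg, AlgHom.commutes, preAction_pt, preAction_pξ]
    rw [opT_lo u v hn i (hj.trans hlo.symm) (hk.trans hhi.symm), hp]
  | t_ξ_other i j hi hj hj' =>
    obtain ⟨hlo, hhi, -⟩ := node_of_le u v hn hi
    simp only [map_mul, map_neg, preAction_pt, preAction_pξ]
    exact opT_of_ne u v hn i (by rwa [hlo]) (by rwa [hhi])
  | A_pi hX r i j hj =>
    subst hX
    simp only [map_mul, map_neg, map_pow, map_one, preAction_ptpi, preAction_pξ]
    refine (opPi_cross_A r).zero_apply_pow (Subtype.ext ?_)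
    rw [rotate_coe]
    grind
  | A_pi_last hX r i j hi hj =>
    subst hX
    simp only [map_mul, map_neg, map_pow, map_one, preAction_ptpi, preAction_pξ]
    refine (opPi_cross_A r).zero_apply_pow (Subtype.ext ?_)
    rw [rotate_coe, if_pos hi, hj]
  | B_ξ_self hX i j hi hj =>
    subst hX
    obtain ⟨hlo, hhi, hp⟩ := nodeB (n := n) u v
    simp only [map_add, map_mul, map_neg, AlgHom.commutes, preAction_pt, preAction_pξ]
    rw [opT_lo u v hn i (k := j) (by rw [hi, hlo, hj]) (by rw [hi, hhi, hj]), hi, hp]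
  | B_ξ_other hX i j hi hj =>
    subst hX
    obtain ⟨hlo, hhi, hp⟩ := nodeB (n := n) u v
    simp only [map_mul, map_neg, preAction_pt, preAction_pξ]
    exact opT_of_ne u v hn i (by rwa [hi, hlo]) (by rwa [hi, hhi])
  | B_pi hX r i =>
    subst hX
    simp only [map_mul, map_neg, preAction_ptpi, preAction_pξ]
    rw [(opPi_cross_B r).zero_apply, neg_one_smul, id]
  | D_ξ_self hX i j k hi hj hk =>
    subst hX
    obtain ⟨hlo, hhi, hp⟩ := nodeD (n := n) u v
    simp only [map_add, map_mul, map_neg, AlgHom.commutes, preAction_pt, preAction_pξ]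
    rw [opT_hi u v hn i (k := k) (by rw [hi, hhi, hj]) (by rw [hi, hlo, hk]), hi, hp]
  | D_ξ_other hX i j hi hj hj' =>
    subst hX
    obtain ⟨hlo, hhi, hp⟩ := nodeD (n := n) u v
    simp only [map_mul, map_neg, preAction_pt, preAction_pξ]
    exact opT_of_ne u v hn i (by rwa [hi, hlo]) (by rwa [hi, hhi])
  | Dodd_pi hX hodd r i j hj =>
    subst hX
    simp only [map_mul, map_neg, map_pow, map_one, preAction_ptpi, preAction_pξ]
    rw [show (n - 1) / 2 = n / 2 by grind]
    exact (opPi_cross_D_last r (piIdx_eq_of_odd hodd r)).zero_apply_pow (Subtype.ext hj.symm)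
  | Deven_pi_one hX heven p hp i =>
    subst hX
    simp only [map_mul, preAction_ptpi, preAction_pξ]
    rw [(opPi_cross_D_one hn p hp).zero_apply, one_smul, id]
  | Deven_pi_n hX heven q hq i j hj =>
    subst hX
    simp only [map_mul, map_neg, map_pow, map_one, preAction_ptpi, preAction_pξ]
    exact (opPi_cross_D_last q hq).zero_apply_pow (Subtype.ext hj.symm)

/-- The action of the double affine Hecke algebra on `𝒞[ξ] ⊗ ℂW^{e-}`. -/
def heckeAction : SpinDoubleHecke X n u v →ₐ[ℂ] Module.End ℂ (PBW X n) :=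
  RingQuot.liftAlgHom ℂ ⟨preAction u v hn, fun _ _ h => preAction_eq u v hn h⟩

theorem heckeAction_mk (a : PreDAHA X n) :
    heckeAction u v hn (SpinDoubleHecke.mk X n u v a) = preAction u v hn a :=
  RingQuot.liftAlgHom_mkAlgHom_apply ℂ _ _ _

theorem heckeAction_fromSkew (a : Skew n) :
    heckeAction u v hn (fromSkew X n u v a) = leftMul n (SpinWeyl X n) a :=
  (heckeAction_mk u v hn (pl a)).trans (preAction_pl u v hn a)

theorem heckeAction_fromSpinWeyl (b : SpinWeyl X n) :
    heckeAction u v hn (fromSpinWeyl X n u v b) = weylAction u v hn b :=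
  (heckeAction_mk u v hn (pr b)).trans (preAction_pr u v hn b)

end HeckeAction

/-! ### The multiplication map -/

section Multiplication

variable {X : ClassicalType} {n : ℕ} (u v : ℂ) (hn : Admissible X n)

/-- In `Ḧ^-_W`, the generator `t_i` obeys its commutation rule with all `ξ_k`. The rule for the
second variable moved by `t_i` is not a defining relation, and follows from `t_i² = 1`. -/
theorem rule_fromSpinWeyl_t (i : Idx (rank X n)) :
    (nodeTwist u v hn i).Rule (fun k => fromSkew X n u v (Skew.ξ k))
      (fromSpinWeyl X n u v (SpinWeyl.t i)) := by
  have hT : fromSpinWeyl X n u v (SpinWeyl.t i) * fromSpinWeyl X n u v (SpinWeyl.t i) = 1 := by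
    rw [← map_mul, SpinWeyl.t_mul_self, map_one]
  have self {j k : Idx n} {c : ℂ}
      (h : DAHARel X n u v (pt i * pξ j) (-(pξ k * pt i) + algebraMap ℂ _ c)) :
      fromSpinWeyl X n u v (SpinWeyl.t i) * fromSkew X n u v (Skew.ξ j) =
        -(fromSkew X n u v (Skew.ξ k) * fromSpinWeyl X n u v (SpinWeyl.t i)) +
          algebraMap ℂ _ c := by
    have := SpinDoubleHecke.mk_rel X n u v h
    simp only [map_add, map_mul, map_neg, AlgHom.commutes] at this
    exact this
  have other {j : Idx n} (h : DAHARel X n u v (pt i * pξ j) (-(pξ j * pt i))) :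
      fromSpinWeyl X n u v (SpinWeyl.t i) * fromSkew X n u v (Skew.ξ j) =
        -(fromSkew X n u v (Skew.ξ j) * fromSpinWeyl X n u v (SpinWeyl.t i)) := by
    have := SpinDoubleHecke.mk_rel X n u v h
    simp only [map_mul, map_neg] at this
    exact this
  by_cases hi : (i : ℕ) ≤ n - 1
  · obtain ⟨hlo, hhi, hp⟩ := node_of_le u v hn hi
    rw [nodeTwist, hp]
    refine Twist.Rule.of_left hT (self (.t_ξ_self i _ _ hi hlo hhi)) fun k hk hk' =>
      other (j := k) (.t_ξ_other i k hi (fun h => hk (Subtype.ext (h.trans hlo.symm)))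
        fun h => hk' (Subtype.ext (h.trans hhi.symm)))
  · have hi' := i.2.2
    cases X with
    | A => exact absurd hi' hi
    | B =>
      have hin : (i : ℕ) = n := by
        simp only [rank] at hi'
        omega
      obtain ⟨hlo, hhi, hp⟩ := nodeB (n := n) u v
      have hlo' : (nodeLo hn i : ℕ) = n := (congrArg (loVal .B n) hin).trans hlo
      have hhi' : nodeHi hn i = nodeLo hn i :=
        Subtype.ext (((congrArg (hiVal .B n) hin).trans hhi).trans hlo'.symm)
      rw [nodeTwist, hin, hp, hhi']
      exact Twist.Rule.of_left hT (self (.B_ξ_self rfl i _ hin hlo')) fun k hk _ =>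
        other (j := k) (.B_ξ_other rfl i k hin fun h => hk (Subtype.ext (h.trans hlo'.symm)))
    | D =>
      have hin : (i : ℕ) = n := by
        simp only [rank] at hi'
        omega
      obtain ⟨hlo, hhi, hp⟩ := nodeD (n := n) u v
      have hlo' : (nodeLo hn i : ℕ) = n - 1 := (congrArg (loVal .D n) hin).trans hlo
      have hhi' : (nodeHi hn i : ℕ) = n := (congrArg (hiVal .D n) hin).trans hhi
      rw [nodeTwist, hin, hp]
      exact Twist.Rule.of_right hT (self (.D_ξ_self rfl i _ _ hin hhi' hlo')) fun k hk hk' =>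
        other (j := k) (.D_ξ_other rfl i k hin
          (fun h => hk (Subtype.ext (h.trans hlo'.symm)))
          fun h => hk' (Subtype.ext (h.trans hhi'.symm)))

theorem rule_fromSpinWeyl_tpi (hn : Admissible X n) (r : PiIdx X n) :
    (piTwist r).Rule (fun k => fromSkew X n u v (Skew.ξ k))
      (fromSpinWeyl X n u v (SpinWeyl.tpi r)) := by
  intro k
  change _ = (-1 : ℂ) ^ (piData X n r).2 • (fromSkew X n u v (Skew.ξ ((piData X n r).1 k)) *
    fromSpinWeyl X n u v (SpinWeyl.tpi r)) + (0 : ℂ) • 1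
  rw [zero_smul, add_zero, Algebra.smul_def, map_pow, map_neg, map_one, ← mul_assoc]
  have key {m : ℕ} {j : Idx n} (h : DAHARel X n u v (ptpi r * pξ k) ((-1) ^ m * pξ j * ptpi r)) :
      fromSpinWeyl X n u v (SpinWeyl.tpi r) * fromSkew X n u v (Skew.ξ k) =
        (-1) ^ m * fromSkew X n u v (Skew.ξ j) * fromSpinWeyl X n u v (SpinWeyl.tpi r) := by
    have := SpinDoubleHecke.mk_rel X n u v h
    simp only [map_mul, map_neg, map_pow, map_one] at this
    exact this
  cases X with
  | A =>
    by_cases hk : (k : ℕ) = n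
    · exact key (.A_pi_last rfl r k _ hk (by simp only [piData, rotate_coe, if_pos hk]))
    · exact key (.A_pi rfl r k _ (by simp only [piData, rotate_coe, if_neg hk]))
  | B =>
    refine key ?_
    have h := DAHARel.B_pi (u := u) (v := v) rfl r k
    simpa [piData] using h
  | D =>
    rcases Nat.even_or_odd n with heven | hodd
    · by_cases hr : (r : ℕ) = n
      · simp only [piData, if_pos hr]
        exact key (.Deven_pi_n rfl heven r hr k _ rfl)
      · refine key ?_
        have h := DAHARel.Deven_pi_one (u := u) (v := v) rfl heven r
          (r.2.resolve_right hr).2 k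
        simpa [piData, if_neg hr] using h
    · simp only [piData, if_pos (piIdx_eq_of_odd hodd r)]
      rw [show n / 2 = (n - 1) / 2 by grind]
      exact key (.Dodd_pi rfl hodd r k _ rfl)

/-- The multiplication map `𝒞[ξ] ⊗ ℂW^{e-} → Ḧ^-_W`. -/
def mulMap (X : ClassicalType) (n : ℕ) (u v : ℂ) : PBW X n →ₗ[ℂ] SpinDoubleHecke X n u v :=
  LinearMap.mul' ℂ _ ∘ₗ
    TensorProduct.map (fromSkew X n u v).toLinearMap (fromSpinWeyl X n u v).toLinearMap

theorem mulMap_tmul (a : Skew n) (b : SpinWeyl X n) :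
    mulMap X n u v (a ⊗ₜ b) = fromSkew X n u v a * fromSpinWeyl X n u v b := rfl

theorem mulMap_leftMul (a : Skew n) (m : PBW X n) :
    mulMap X n u v (leftMul n _ a m) = fromSkew X n u v a * mulMap X n u v m := by
  induction m using TensorProduct.induction_on with
  | zero => simp
  | tmul a' b => rw [leftMul_tmul, mulMap_tmul, mulMap_tmul, map_mul, mul_assoc]
  | add m m' h h' => rw [map_add, map_add, map_add, h, h', mul_add]

/-- Multiplication intertwines the operator attached to `g` with left multiplication by `g`, provided
that `g` obeys in `Ḧ^-_W` the commutation rule of the operator. -/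
theorem mulMap_op {τ : Twist n} {g : SpinWeyl X n}
    (hg : τ.Rule (fun k => fromSkew X n u v (Skew.ξ k)) (fromSpinWeyl X n u v g)) (m : PBW X n) :
    mulMap X n u v (τ.op g m) = fromSpinWeyl X n u v g * mulMap X n u v m := by
  suffices h : mulMap X n u v ∘ₗ τ.op g =
      LinearMap.mulLeft ℂ (fromSpinWeyl X n u v g) ∘ₗ mulMap X n u v from LinearMap.congr_fun h m
  refine eq_of_tmul_one_of_mulξ (fun b => ?_) fun k m h => ?_
  · rw [LinearMap.comp_apply, LinearMap.comp_apply, Twist.op_one_tmul, mulMap_tmul, mulMap_tmul,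
      map_one, one_mul, one_mul, map_mul, LinearMap.mulLeft_apply]
  · have hop := LinearMap.congr_fun (τ.cross_op g k) m
    simp only [Module.End.mul_apply, LinearMap.add_apply, LinearMap.smul_apply,
      Module.End.one_apply] at hop
    simp only [LinearMap.comp_apply, LinearMap.mulLeft_apply] at h ⊢
    rw [hop, map_add, map_smul, map_smul, mulξ, mulξ, mulMap_leftMul, mulMap_leftMul, h,
      ← mul_assoc (fromSpinWeyl X n u v g), hg k, add_mul, smul_mul_assoc, smul_mul_assoc, one_mul,
      mul_assoc]

theorem mulMap_wordUnit (w : FreeGroup (CoverGen X n)) (m : PBW X n) :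
    mulMap X n u v ((wordUnit u v hn w : Module.End ℂ (PBW X n)) m) =
      fromSpinWeyl X n u v (SpinWeyl.ofWord X n w) * mulMap X n u v m := by
  have key (g : CoverGen X n) (m : PBW X n) :
      mulMap X n u v ((wordUnit u v hn (.of g) : Module.End ℂ (PBW X n)) m) =
        fromSpinWeyl X n u v (SpinWeyl.ofWord X n (.of g)) * mulMap X n u v m := by
    cases g with
    | z =>
      change mulMap X n u v ((wordUnit u v hn wz : Module.End ℂ (PBW X n)) m) =
        fromSpinWeyl X n u v (SpinWeyl.ofWord X n wz) * _
      rw [wordUnit_wz, SpinWeyl.ofWord_wz, map_neg, map_one, neg_one_mul, ← map_neg]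
      rfl
    | t i =>
      change mulMap X n u v ((wordUnit u v hn (wt i) : Module.End ℂ (PBW X n)) m) = _
      rw [wordUnit_wt]
      exact mulMap_op u v (rule_fromSpinWeyl_t u v hn i) m
    | pi r =>
      change mulMap X n u v ((wordUnit u v hn (wpi r) : Module.End ℂ (PBW X n)) m) = _
      rw [wordUnit_wpi]
      exact mulMap_op u v (rule_fromSpinWeyl_tpi u v hn r) m
  induction w using FreeGroup.induction_on generalizing m with
  | C1 => simp
  | of g => exact key g m
  | inv_of g h =>
    have h' := key g ((wordUnit u v hn (.of g)⁻¹ : Module.End ℂ (PBW X n)) m)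
    rw [← Module.End.mul_apply, ← Units.val_mul, ← map_mul, mul_inv_cancel, map_one, Units.val_one,
      Module.End.one_apply] at h'
    rw [h', ← mul_assoc, ← map_mul, ← map_mul, inv_mul_cancel, map_one, map_one, one_mul]
  | mul w w' h h' =>
    rw [map_mul, Units.val_mul, Module.End.mul_apply, h, h', map_mul, map_mul, mul_assoc]

theorem mulMap_weylAction (b : SpinWeyl X n) (m : PBW X n) :
    mulMap X n u v (weylAction u v hn b m) = fromSpinWeyl X n u v b * mulMap X n u v m := by
  induction b using SpinWeyl.induction with
  | word w => rw [weylAction_ofWord, mulMap_wordUnit]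
  | add a b ha hb => rw [map_add, LinearMap.add_apply, map_add, ha, hb, map_add, add_mul]
  | smul c a ha => rw [map_smul, LinearMap.smul_apply, map_smul, ha, map_smul, smul_mul_assoc]

/-- The multiplication map is equivariant; it is therefore onto, its image being a left ideal that
contains `1`. -/
theorem mulMap_heckeAction (h : SpinDoubleHecke X n u v) (m : PBW X n) :
    mulMap X n u v (heckeAction u v hn h m) = h * mulMap X n u v m := by
  obtain ⟨f, rfl⟩ : ∃ f, SpinDoubleHecke.mk X n u v f = h :=
    RingQuot.mkAlgHom_surjective ℂ (DAHARel X n u v) h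
  rw [heckeAction_mk]
  induction f using FreeAlgebra.induction generalizing m with
  | grade0 c =>
    rw [AlgHom.commutes, AlgHom.commutes, Module.algebraMap_end_apply, map_smul, Algebra.smul_def]
  | grade1 g =>
    cases g with
    | inl a =>
      change mulMap X n u v (preAction u v hn (pl a) m) = fromSkew X n u v a * _
      rw [preAction_pl, mulMap_leftMul]
    | inr b =>
      change mulMap X n u v (preAction u v hn (pr b) m) = fromSpinWeyl X n u v b * _
      rw [preAction_pr, mulMap_weylAction]
  | mul f g hf hg => rw [map_mul, map_mul, Module.End.mul_apply, hf, hg, mul_assoc]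
  | add f g hf hg => rw [map_add, map_add, LinearMap.add_apply, map_add, hf, hg, add_mul]

/-- The inverse of the multiplication map: `h` is sent to `h · (1 ⊗ 1)`. -/
def orbitMap : SpinDoubleHecke X n u v →ₗ[ℂ] PBW X n :=
  (LinearMap.applyₗ (1 ⊗ₜ 1 : PBW X n)) ∘ₗ (heckeAction u v hn).toLinearMap

theorem orbitMap_apply (h : SpinDoubleHecke X n u v) :
    orbitMap u v hn h = heckeAction u v hn h (1 ⊗ₜ 1) := rfl

/-- The isomorphism `𝒞[ξ] ⊗ ℂW^{e-} ≃ Ḧ^-_W` given by multiplication. -/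
def mulEquiv : PBW X n ≃ₗ[ℂ] SpinDoubleHecke X n u v :=
  LinearEquiv.ofLinearMap (mulMap X n u v) (orbitMap u v hn)
    (LinearMap.ext fun h => by
      rw [LinearMap.comp_apply, orbitMap_apply, mulMap_heckeAction, mulMap_tmul, map_one, map_one,
        mul_one, mul_one, LinearMap.id_apply])
    (TensorProduct.ext' fun a b => by
      rw [LinearMap.comp_apply, mulMap_tmul, orbitMap_apply, map_mul, Module.End.mul_apply,
        heckeAction_fromSkew, heckeAction_fromSpinWeyl, weylAction_one_tmul, leftMul_tmul, mul_one,
        mul_one, LinearMap.id_apply])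

end Multiplication

end

end SpinDAHA

theorem mainTheorem4 (X : SpinDAHA.ClassicalType) (n : ℕ) (hn : SpinDAHA.Admissible X n)
    (u v : ℂ) :
    ∃ e : (SpinDAHA.Skew n ⊗[ℂ] SpinDAHA.SpinWeyl X n) ≃ₗ[ℂ] SpinDAHA.SpinDoubleHecke X n u v,
      ∀ (a : SpinDAHA.Skew n) (b : SpinDAHA.SpinWeyl X n),
        e (a ⊗ₜ[ℂ] b) = SpinDAHA.fromSkew X n u v a * SpinDAHA.fromSpinWeyl X n u v b :=
  ⟨SpinDAHA.mulEquiv u v hn, fun _ _ => rfl⟩
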